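/- A stratified group is realised as a homogeneous Carnot group: $\mathbb G=(\mathbb R^d,\circ,\delta_t)$, where $\circ$ is a Lie group law on $\mathbb R^d$ with identity $0$, the dilations $\delta_t(x)=(t^{w_1}x_1,\dots,t^{w_d}x_d)$, $t>0$, with integer weights $w_i\ge 1$, are automorphisms of $\circ$, and the left-invariant vector fields $X_i$ with $X_i(0)=\partial/\partial x_i$, $w_i=1$ (the first layer), generate together with their iterated commutators the tangent space at every point. Write $\nabla f=(X_if)_{w_i=1}$ for the sub-gradient, $|\nabla f|$ for its Euclidean length, and $\lambda$ for the Lebesgue measure on $\mathbb R^d$ (a Haar measure of $\mathbb G$). A smooth homogeneous norm on $\mathbb G$ is a continuous function $N:\mathbb G\to[0,\infty)$ that vanishes exactly at $0$, satisfies $N(\delta_t x)=tN(x)$ for all $t>0$, and is $C^\infty$ on $\mathbb G\setminus\{0\}$. For $0<\beta\le1$ and $q>1$, a measure $\mu$ on $\mathbb G$ satisfies the Log$^\beta$-Sobolev inequality with exponent $q$ if there are constants $C,D\in[0,\infty)$ such that $$\int|f|^q\left|\log\frac{|f|^q}{\int|f|^q\,d\mu}\right|^\beta d\mu\le C\int|\nabla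 f|^q\,d\mu+D\int|f|^q\,d\mu$$ for all locally Lipschitz functions $f$ for which $|f|^q$ and $|\nabla f|^q$ are $\mu$-integrable. Theorem 10. Let $\mathbb G$ be a non-commutative stratified group, let $N$ be a smooth homogeneous norm on $\mathbb G$, let $\alpha>0$ and $p\ge1$, and let $d\mu=\frac{e^{-\alpha N^p}}{Z}\,d\lambda$ with $Z=\int e^{-\alpha N^p}\,d\lambda$. Then, for every $0<\beta\le1$ and every $q$ with $1<q<\frac{2p\beta}{p-1}$ (every $q>1$ if $p=1$), the measure $\mu$ does not satisfy the Log$^\beta$-Sobolev inequality with exponent $q$. -/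

import Mathlib

open MeasureTheory
open scoped ContDiff

noncomputable section

/-- The dilation `δ_t x = (t ^ w₁ x₁, …, t ^ w_d x_d)` of `ℝ^d` with weights `w`. -/
def dilation {d : ℕ} (w : Fin d → ℕ) (t : ℝ) (x : Fin d → ℝ) : Fin d → ℝ :=
  fun i => t ^ w i * x i

/-- For a group law `mul` on `ℝ^d` with identity `0`: the left-invariant vector field that equals
`∂/∂x_i` at `0`, that is, the `i`-th column of the Jacobian matrix at `0` of the left
translation by `x`. -/
def leftField {d : ℕ} (mul : (Fin d → ℝ) → (Fin d → ℝ) → (Fin d → ℝ)) (i : Fin d) :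
    (Fin d → ℝ) → (Fin d → ℝ) :=
  fun x => fderiv ℝ (mul x) 0 (Pi.single i 1)

/-- The iterated commutators of the fields `X i`, for the indices `i` with `P i`
(the fields themselves included). -/
inductive IteratedCommutator {d : ℕ} (X : Fin d → (Fin d → ℝ) → (Fin d → ℝ)) (P : Fin d → Prop) :
    ((Fin d → ℝ) → (Fin d → ℝ)) → Prop
  | base (i : Fin d) (hi : P i) : IteratedCommutator X P (X i)
  | bracket (V W : (Fin d → ℝ) → (Fin d → ℝ)) (hV : IteratedCommutator X P V)
      (hW : IteratedCommutator X P W) : IteratedCommutator X P (VectorField.lieBracket ℝ V W)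

/-- A stratified (Carnot) group, realised on `ℝ^d` as a homogeneous Carnot group: a Lie group
structure on `ℝ^d` with identity `0`, such that the dilations with positive integer weights are
group automorphisms, and such that the left-invariant fields which extend `∂/∂x_i` for the
coordinates `i` of weight one (the first layer) generate, under commutators, the whole tangent
space at every point. -/
structure StratifiedGroup (d : ℕ) where
  weight : Fin d → ℕ
  weight_pos : ∀ i, 1 ≤ weight i
  mul : (Fin d → ℝ) → (Fin d → ℝ) → (Fin d → ℝ)
  inv : (Fin d → ℝ) → (Fin d → ℝ)
  mul_assoc : ∀ x y z, mul (mul x y) z = mul x (mul y z)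
  zero_mul : ∀ x, mul 0 x = x
  mul_zero : ∀ x, mul x 0 = x
  inv_mul : ∀ x, mul (inv x) x = 0
  contDiff_mul : ContDiff ℝ ∞ (fun z : (Fin d → ℝ) × (Fin d → ℝ) => mul z.1 z.2)
  contDiff_inv : ContDiff ℝ ∞ inv
  dilation_mul : ∀ t : ℝ, 0 < t → ∀ x y,
    dilation weight t (mul x y) = mul (dilation weight t x) (dilation weight t y)
  generates : ∀ x : Fin d → ℝ, Submodule.span ℝ
    {v | ∃ Y, IteratedCommutator (leftField mul) (fun i => weight i = 1) Y ∧ v = Y x} = ⊤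

namespace StratifiedGroup

variable {d : ℕ} (G : StratifiedGroup d)

/-- The group is not abelian (equivalently, its step is at least two). -/
def Noncommutative : Prop := ∃ x y, G.mul x y ≠ G.mul y x

/-- `N` is a smooth homogeneous norm: continuous, positive away from the identity and zero there,
homogeneous of degree one under the dilations, and `C^∞` away from the identity. -/
structure IsSmoothHomogeneousNorm (N : (Fin d → ℝ) → ℝ) : Prop where
  continuous : Continuous N
  nonneg : ∀ x, 0 ≤ N x
  eq_zero_iff : ∀ x, N x = 0 ↔ x = 0
  homogeneous : ∀ t : ℝ, 0 < t → ∀ x, N (dilation G.weight t x) = t * N x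
  smooth : ContDiffOn ℝ ∞ N {0}ᶜ

/-- The length `|∇f|(x)` of the sub-gradient `∇f = (X_i f)`, where `i` runs through the coordinates
of weight one. -/
def subgradNorm (f : (Fin d → ℝ) → ℝ) (x : Fin d → ℝ) : ℝ :=
  Real.sqrt (∑ i with G.weight i = 1, (fderiv ℝ f x (leftField G.mul i x)) ^ 2)

/-- The `Log^β`-Sobolev inequality with exponent `q`: there are constants `C, D ∈ [0, ∞)` with
`μ(|f|^q |log(|f|^q / μ|f|^q)|^β) ≤ C μ|∇f|^q + D μ|f|^q`
for all locally Lipschitz `f` for which the right-hand side is finite. -/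
def LogSobolev (μ : Measure (Fin d → ℝ)) (β q : ℝ) : Prop :=
  ∃ C D : ℝ, 0 ≤ C ∧ 0 ≤ D ∧ ∀ f : (Fin d → ℝ) → ℝ, LocallyLipschitz f →
    Integrable (fun x => |f x| ^ q) μ → Integrable (fun x => G.subgradNorm f x ^ q) μ →
    ∫⁻ x, ENNReal.ofReal (|f x| ^ q * |Real.log (|f x| ^ q / ∫ y, |f y| ^ q ∂μ)| ^ β) ∂μ ≤
      ENNReal.ofReal (C * ∫ x, G.subgradNorm f x ^ q ∂μ + D * ∫ x, |f x| ^ q ∂μ)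

end StratifiedGroup

/-- The measure `dμ = e^{-α N^p} dλ / Z`, with `λ` the Lebesgue measure on `ℝ^d` (a Haar measure of
the group) and `Z = ∫ e^{-α N^p} dλ`. -/
def gibbsMeasure {d : ℕ} (N : (Fin d → ℝ) → ℝ) (α p : ℝ) : Measure (Fin d → ℝ) :=
  (∫⁻ x, ENNReal.ofReal (Real.exp (-α * N x ^ p)))⁻¹ •
    volume.withDensity (fun x => ENNReal.ofReal (Real.exp (-α * N x ^ p)))

end

/-! The obstruction is a point `x₀ ≠ 0` at which every first-layer derivative of `N` vanishes
(`exists_horizontal_critical_point`). Suppose there were none. A coordinate `j` of weight at least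
two gives a direction outside the first layer, so the frame field of the horizontal gradient can be
joined near `0` to the nonvanishing left-invariant field `X_j`. Far away it can be joined to the
Euler field `(w_i x_i)`, since `N` increases along both. The result is a nonvanishing field on `ℝ^d`
that equals the Euler field near infinity, which contradicts the no-retraction principle
(`exists_eq_zero_of_eq_id_off_ball`).

At `x₀` the function `k ↦ N (x₀ · δ_ε k) ^ p` varies only by `O(ε²)`: first-layer directions have no
linear term, and all other coordinates scale at least like `ε²`. Dilating by `t` multiplies this by
`t ^ p`. With `ε = t ^ (-p/2)`, the density of the measure is therefore constant up to bounded
factors on a translated ball of radius `r = t ^ (1 - p/2)` about `δ_t x₀`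
(`exists_oscillation_bound`).

A cutoff function of that ball has sub-gradient at most a constant times `1 / r`, and the mass of
the ball is exponentially small in `t ^ p`. The inequality then forces `t ^ (pβ) ≲ t ^ (q(p/2 - 1))
+ 1` (`LogSobolev.growth_bound`). This fails for large `t` as soon as `q(p/2 - 1) < pβ`, which the
assumption on `q` implies. -/

noncomputable section

/-! ### No-retraction principle by a volume argument -/

section NoRetraction

open Metric Set Polynomial

/-- The degree bound does not depend on `A`, so one set of interpolation nodes and weights serves
all derivatives `fderiv ℝ u x` at once. -/
theorem exists_polynomial_det_one_add_smul {E : Type*} [NormedAddCommGroup E] [NormedSpace ℝ E]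
    [FiniteDimensional ℝ E] (A : E →L[ℝ] E) :
    ∃ P : ℝ[X], P.natDegree ≤ Module.finrank ℝ E ∧
      ∀ t : ℝ, P.eval t = (1 + t • A).det := by
  let b := Module.finBasis ℝ E
  let M := LinearMap.toMatrix b b (A : E →ₗ[ℝ] E)
  refine ⟨((X : ℝ[X]) • M.map C + (1 : Matrix _ _ ℝ).map C).det, ?_, fun t => ?_⟩
  · simpa using Polynomial.natDegree_det_X_add_C_le M 1
  · have h : (1 + t • A).det = (1 + t • M).det := by
      rw [ContinuousLinearMap.det, ← LinearMap.det_toMatrix b]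
      congr 1
      simp [M, LinearMap.toMatrix_one]
    rw [h, ← Polynomial.coe_evalRingHom, RingHom.map_det]
    congr 1
    ext i j
    by_cases hij : i = j <;> simp [hij, mul_comm t, add_comm]

/-- Extrapolation of the values of `t ↦ det (1 + t A)` from a small interval to `t = 1`, with
coefficients that do not depend on `A`. -/
theorem exists_extrapolation_det_one_add {E : Type*} [NormedAddCommGroup E] [NormedSpace ℝ E]
    [FiniteDimensional ℝ E] {ε : ℝ} (hε : 0 < ε) :
    ∃ (s : Finset ℕ) (c τ : ℕ → ℝ), (∀ i ∈ s, 0 < τ i ∧ τ i < ε) ∧ ∑ i ∈ s, c i = 1 ∧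
      ∀ A : E →L[ℝ] E, (1 + A).det = ∑ i ∈ s, c i * (1 + τ i • A).det := by
  classical
  set n := Module.finrank ℝ E
  set s := Finset.range (n + 1)
  -- The shift by 2 keeps the nodes strictly below `ε`, also for `i = 0`. The weights are the
  -- Lagrange basis polynomials evaluated at `1`.
  let τ : ℕ → ℝ := fun i => ε / (i + 2)
  have hinj : Set.InjOn τ s := by
    intro i _ j _ h
    have h' : ε / ((i : ℝ) + 2) = ε / ((j : ℝ) + 2) := h
    rw [div_eq_div_iff (by positivity) (by positivity)] at h'
    have := mul_left_cancel₀ hε.ne' h'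
    exact_mod_cast (add_right_cancel this).symm
  refine ⟨s, fun i => (Lagrange.basis s τ i).eval 1, τ, fun i _ => ⟨by positivity, ?_⟩, ?_, ?_⟩
  · rw [div_lt_iff₀ (by positivity)]
    nlinarith [(Nat.cast_nonneg i : (0 : ℝ) ≤ i)]
  · rw [← Polynomial.eval_finsetSum, Lagrange.sum_basis hinj ⟨0, by simp [s]⟩]
    simp
  · intro A
    obtain ⟨P, hP, hev⟩ := exists_polynomial_det_one_add_smul A
    have h1 := hev 1
    rw [one_smul] at h1
    have hdeg : P.degree < (s.card : WithBot ℕ) := by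
      refine lt_of_le_of_lt Polynomial.degree_le_natDegree ?_
      rw [Finset.card_range]
      exact_mod_cast Nat.lt_succ_of_le hP
    rw [← h1]
    conv_lhs => rw [Lagrange.eq_interpolate hinj hdeg]
    rw [Lagrange.interpolate_apply, Polynomial.eval_finsetSum]
    refine Finset.sum_congr rfl fun i _ => ?_
    rw [Polynomial.eval_mul, Polynomial.eval_C, hev, mul_comm]

/-- A perturbation of the identity with Lipschitz constant below one is bijective. It fixes every
point outside the ball, so it cannot exchange inside and outside. -/
theorem image_ball_id_add {E : Type*} [NormedAddCommGroup E] [NormedSpace ℝ E]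
    [FiniteDimensional ℝ E] {u : E → E} {L : NNReal} (hL : L < 1) (hu : LipschitzWith L u) {R : ℝ}
    (hR : ∀ x, R ≤ ‖x‖ → u x = 0) :
    Function.Injective (fun x => x + u x) ∧ (fun x => x + u x) '' ball 0 R = ball 0 R := by
  have happ : ApproximatesLinearOn (fun x => x + u x)
      ((ContinuousLinearEquiv.refl ℝ E : E ≃L[ℝ] E) : E →L[ℝ] E) univ L := by
    intro x _ y _
    have := hu.dist_le_mul x y
    rw [dist_eq_norm, dist_eq_norm] at this
    simpa [add_sub_add_comm] using this
  have hc : Subsingleton E ∨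
      L < ‖((ContinuousLinearEquiv.refl ℝ E).symm : E →L[ℝ] E)‖₊⁻¹ := by
    rcases subsingleton_or_nontrivial E with h | h
    · exact Or.inl h
    · right
      have : ((ContinuousLinearEquiv.refl ℝ E).symm : E →L[ℝ] E) = ContinuousLinearMap.id ℝ E := rfl
      rw [this, ContinuousLinearMap.nnnorm_id]
      simpa using hL
  have hinj : Function.Injective (fun x => x + u x) := by
    intro x y h
    exact happ.injOn hc (mem_univ x) (mem_univ y) h
  have hsurj := happ.surjective hc
  refine ⟨hinj, Set.Subset.antisymm ?_ ?_⟩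
  · rintro _ ⟨x, hx, rfl⟩
    by_contra hy
    have h0 : R ≤ ‖x + u x‖ := by simpa using hy
    have h1 : (x + u x) + u (x + u x) = x + u x := by rw [hR _ h0, add_zero]
    have h2 : x + u x = x := hinj h1
    exact hy (by simpa only [h2] using hx)
  · intro y hy
    obtain ⟨x, rfl⟩ := hsurj y
    refine ⟨x, ?_, rfl⟩
    by_contra hx
    have h0 : R ≤ ‖x‖ := by simpa using hx
    have : x + u x = x := by rw [hR x h0, add_zero]
    simp only [this] at hy
    exact hx hy

/-- This removes the absolute value from the Jacobian in the change of variables. -/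
theorem eventually_det_one_add_pos (E : Type*) [NormedAddCommGroup E] [NormedSpace ℝ E]
    [FiniteDimensional ℝ E] :
    ∃ δ > 0, ∀ M : E →L[ℝ] E, ‖M‖ < δ → 0 < (1 + M).det := by
  have hcont : Continuous fun M : E →L[ℝ] E => (1 + M).det :=
    ContinuousLinearMap.continuous_det.comp (continuous_const.add continuous_id)
  have h0 : 0 < (1 + (0 : E →L[ℝ] E)).det := by
    simp [ContinuousLinearMap.det]
  obtain ⟨δ, hδ, h⟩ := Metric.eventually_nhds_iff.1 (hcont.continuousAt.eventually (lt_mem_nhds h0))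
  exact ⟨δ, hδ, fun M hM => h (by simpa using hM)⟩

/-- A Lipschitz perturbation of the identity that is supported in a ball preserves its signed
volume. -/
theorem setIntegral_det_one_add_fderiv {E : Type*} [NormedAddCommGroup E] [NormedSpace ℝ E]
    [FiniteDimensional ℝ E] [MeasurableSpace E] [BorelSpace E] (μ : Measure E)
    [μ.IsAddHaarMeasure] {u : E → E} {L : NNReal} (hu : LipschitzWith L u) {R : ℝ}
    (hR : ∀ x, R ≤ ‖x‖ → u x = 0) (hd : ∀ x ∈ ball (0 : E) R, DifferentiableAt ℝ u x) :
    ∫ x in ball (0 : E) R, (1 + fderiv ℝ u x).det ∂μ = μ.real (ball 0 R) := by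
  obtain ⟨δ, hδ, hpos⟩ := eventually_det_one_add_pos E
  -- Below this threshold `x + t • u x` is a bijection of the ball and has positive Jacobian, so its
  -- Jacobian integrates to the volume of the ball. Extrapolation carries this to `t = 1`, where
  -- neither property need hold.
  have hε : 0 < min 1 δ / (L + 1) := by positivity
  obtain ⟨s, c, τ, hτ, hc, hdet⟩ := exists_extrapolation_det_one_add (E := E) hε
  have hnorm : ∀ x, ‖fderiv ℝ u x‖ ≤ L := fun x => norm_fderiv_le_of_lipschitz ℝ hu
  have hmeas : ∀ t : ℝ, Measurable fun x => (1 + t • fderiv ℝ u x).det := fun t =>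
    ContinuousLinearMap.continuous_det.measurable.comp
      (((measurable_fderiv ℝ u).const_smul t).const_add 1)
  have hint : ∀ t : ℝ, IntegrableOn (fun x => (1 + t • fderiv ℝ u x).det) (ball 0 R) μ := by
    intro t
    have hcpt : IsCompact (closedBall (0 : E →L[ℝ] E) L) := isCompact_closedBall _ _
    have hcont : Continuous fun M : E →L[ℝ] E => (1 + t • M).det :=
      ContinuousLinearMap.continuous_det.comp (by fun_prop)
    obtain ⟨K, hK⟩ := hcpt.exists_bound_of_continuousOn hcont.continuousOn
    refine Measure.integrableOn_of_bounded (M := K) measure_ball_lt_top.ne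
      (hmeas t).aestronglyMeasurable (Filter.Eventually.of_forall fun x => hK _ ?_)
    simpa using hnorm x
  have hval : ∀ i ∈ s, ∫ x in ball (0 : E) R, (1 + τ i • fderiv ℝ u x).det ∂μ =
      μ.real (ball 0 R) := by
    intro i hi
    obtain ⟨h0, h1⟩ := hτ i hi
    have hsmall : τ i * (L + 1) < min 1 δ := (lt_div_iff₀ (by positivity)).1 h1
    have hlip : LipschitzWith (Real.toNNReal (τ i) * L) (fun x => τ i • u x) := by
      refine LipschitzWith.of_dist_le_mul fun x y => ?_
      rw [dist_smul₀, Real.norm_of_nonneg h0.le, NNReal.coe_mul, Real.coe_toNNReal _ h0.le, mul_assoc]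
      exact mul_le_mul_of_nonneg_left (hu.dist_le_mul x y) h0.le
    have hlt : Real.toNNReal (τ i) * L < 1 := by
      rw [← NNReal.coe_lt_coe, NNReal.coe_mul, Real.coe_toNNReal _ h0.le, NNReal.coe_one]
      nlinarith [min_le_left 1 δ]
    obtain ⟨hinj, himg⟩ := image_ball_id_add hlt hlip (R := R) fun x hx => by rw [hR x hx, smul_zero]
    have hder : ∀ x ∈ ball (0 : E) R,
        HasFDerivWithinAt (fun x => x + τ i • u x) (1 + τ i • fderiv ℝ u x) (ball 0 R) x :=
      fun x hx => ((hasFDerivAt_id x).add ((hd x hx).hasFDerivAt.const_smul (τ i))).hasFDerivWithinAt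
    have key := lintegral_abs_det_fderiv_eq_addHaar_image μ measurableSet_ball hder hinj.injOn
    rw [himg] at key
    have hp : ∀ x, 0 < (1 + τ i • fderiv ℝ u x).det := by
      intro x
      refine hpos _ ?_
      rw [norm_smul, Real.norm_of_nonneg h0.le]
      have := hnorm x
      nlinarith [min_le_right 1 δ]
    rw [integral_eq_lintegral_of_nonneg_ae (Filter.Eventually.of_forall fun x => (hp x).le)
      (hmeas _).aestronglyMeasurable, Measure.real, ← key]
    simp_rw [abs_of_pos (hp _)]
  calc ∫ x in ball (0 : E) R, (1 + fderiv ℝ u x).det ∂μ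
      = ∫ x in ball (0 : E) R, ∑ i ∈ s, c i * (1 + τ i • fderiv ℝ u x).det ∂μ := by
        exact integral_congr_ae (Filter.Eventually.of_forall fun x => hdet _)
    _ = ∑ i ∈ s, c i * ∫ x in ball (0 : E) R, (1 + τ i • fderiv ℝ u x).det ∂μ := by
        rw [integral_finsetSum _ fun i _ => (hint (τ i)).const_mul (c i)]
        simp_rw [integral_const_mul]
    _ = μ.real (ball 0 R) := by
        rw [Finset.sum_congr rfl fun i hi => by rw [hval i hi], ← Finset.sum_mul, hc, one_mul]

/-- A segment from inside to outside meets the sphere, where `v` vanishes; comparing with that point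
loses nothing in the constant. -/
theorem lipschitzWith_indicator_ball {E F : Type*} [NormedAddCommGroup E] [NormedSpace ℝ E]
    [NormedAddCommGroup F] {v : E → F} {L : NNReal} {R : ℝ}
    (hv : LipschitzOnWith L v (closedBall 0 R)) (hS : ∀ x, ‖x‖ = R → v x = 0) :
    LipschitzWith L ((ball (0 : E) R).indicator v) := by
  have key : ∀ x ∈ ball (0 : E) R, ∀ y ∉ ball (0 : E) R, dist (v x) 0 ≤ L * dist x y := by
    intro x hx y hy
    have hcont : ContinuousOn (fun s : ℝ => ‖AffineMap.lineMap x y s‖) (Icc 0 1) :=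
      (AffineMap.lineMap_continuous.norm).continuousOn
    have hR : R ∈ Icc ‖AffineMap.lineMap x y (0 : ℝ)‖ ‖AffineMap.lineMap x y (1 : ℝ)‖ := by
      simp only [AffineMap.lineMap_apply_zero, AffineMap.lineMap_apply_one]
      exact ⟨by simpa using (mem_ball_zero_iff.1 hx).le, by simpa using hy⟩
    obtain ⟨s, hs, hsR⟩ := intermediate_value_Icc zero_le_one hcont hR
    have h1 := hv.dist_le_mul x (ball_subset_closedBall hx) (AffineMap.lineMap x y s)
      (by simpa using hsR.le)
    rw [hS _ hsR] at h1
    refine h1.trans (mul_le_mul_of_nonneg_left ?_ L.2)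
    rw [dist_left_lineMap, Real.norm_of_nonneg hs.1]
    exact mul_le_of_le_one_left dist_nonneg hs.2
  refine LipschitzWith.of_dist_le_mul fun x y => ?_
  by_cases hx : x ∈ ball (0 : E) R <;> by_cases hy : y ∈ ball (0 : E) R
  · rw [indicator_of_mem hx, indicator_of_mem hy]
    exact hv.dist_le_mul x (ball_subset_closedBall hx) y (ball_subset_closedBall hy)
  · rw [indicator_of_mem hx, indicator_of_notMem hy]
    exact key x hx y hy
  · rw [indicator_of_notMem hx, indicator_of_mem hy, dist_comm, dist_comm x]
    exact key y hy x hx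
  · rw [indicator_of_notMem hx, indicator_of_notMem hy, dist_self]
    positivity

/-- Differentiating `‖k‖² = 1` shows that the range of the derivative is orthogonal to `k x ≠ 0`, so
the derivative is not surjective. -/
theorem det_fderiv_eq_zero_of_norm_eq_one {E : Type*} [NormedAddCommGroup E]
    [InnerProductSpace ℝ E] [FiniteDimensional ℝ E] {k : E → E} (hk : Differentiable ℝ k)
    (h1 : ∀ x, ‖k x‖ = 1) (c : ℝ) (x : E) : (c • fderiv ℝ k x).det = 0 := by
  by_contra hdet
  have hU : IsUnit ((c • fderiv ℝ k x : E →L[ℝ] E) : E →ₗ[ℝ] E) :=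
    (LinearMap.isUnit_iff_isUnit_det _).2 (isUnit_iff_ne_zero.2 hdet)
  obtain ⟨v, hv⟩ := ((Module.End.isUnit_iff _).1 hU).2 (k x)
  have hd : HasFDerivAt (fun y => inner ℝ (k y) (k y)) _ x :=
    (hk x).hasFDerivAt.inner ℝ (hk x).hasFDerivAt
  have hconst : (fun y => inner ℝ (k y) (k y)) = fun _ => (1 : ℝ) := by
    funext y
    rw [real_inner_self_eq_norm_sq, h1, one_pow]
  rw [hconst] at hd
  have h0 := congrArg (fun M : E →L[ℝ] ℝ => M v) (hd.unique (hasFDerivAt_const (1 : ℝ) x))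
  have hv' : c • fderiv ℝ k x v = k x := hv
  simp only [ContinuousLinearMap.comp_apply, ContinuousLinearMap.prod_apply,
    fderivInnerCLM_apply, zero_apply] at h0
  rw [real_inner_comm (k x), ← two_mul] at h0
  have h2 : inner ℝ (k x) (fderiv ℝ k x v) = 0 := by
    linarith
  have h3 : inner ℝ (k x) (k x) = (0 : ℝ) := by
    conv_lhs => rw [← hv', real_inner_smul_right, hv', h2, mul_zero]
  rw [real_inner_self_eq_norm_sq, h1] at h3
  norm_num at h3

/-- The identity of the sphere is not null-homotopic in the punctured space. -/
theorem exists_eq_zero_of_eq_id_off_ball {E : Type*} [NormedAddCommGroup E]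
    [InnerProductSpace ℝ E] [FiniteDimensional ℝ E] {g : E → E} (hg : ContDiff ℝ 1 g) {r : ℝ}
    (hr : ∀ x, r ≤ ‖x‖ → g x = x) : ∃ x, g x = 0 := by
  by_contra! hne
  borelize E
  set R := max r 1
  have hRpos : 0 < R := lt_of_lt_of_le one_pos (le_max_right _ _)
  set k : E → E := fun x => ‖g x‖⁻¹ • g x
  have hk : ContDiff ℝ 1 k :=
    ((hg.norm ℝ hne).inv fun x => norm_ne_zero_iff.2 (hne x)).smul hg
  have hk1 : ∀ x, ‖k x‖ = 1 := fun x => norm_smul_inv_norm (𝕜 := ℝ) (hne x)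
  -- On the ball, `x + v x = R • k x` takes values in a sphere, so its Jacobian vanishes
  -- identically, whereas volume preservation would make the integral positive.
  set v : E → E := fun x => R • k x - x
  have hv : ContDiff ℝ 1 v := (hk.const_smul R).sub contDiff_id
  have hvS : ∀ x, ‖x‖ = R → v x = 0 := by
    intro x hx
    have hgx := hr x (by rw [hx]; exact le_max_left _ _)
    simp only [v, k, hgx, hx, smul_smul, mul_inv_cancel₀ hRpos.ne', one_smul, sub_self]
  obtain ⟨L, hL⟩ := hv.contDiffOn.exists_lipschitzOnWith one_ne_zero
    (convex_closedBall (0 : E) R) (isCompact_closedBall 0 R)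
  set u := (ball (0 : E) R).indicator v
  have hu : LipschitzWith L u := lipschitzWith_indicator_ball hL hvS
  have hev : ∀ x ∈ ball (0 : E) R, u =ᶠ[nhds x] v := fun x hx =>
    Filter.eventually_of_mem (isOpen_ball.mem_nhds hx) fun y hy => indicator_of_mem hy v
  have hdv : Differentiable ℝ v := hv.differentiable one_ne_zero
  have hvol := setIntegral_det_one_add_fderiv (MeasureTheory.Measure.addHaar : Measure E) hu
    (R := R) (fun x hx => indicator_of_notMem (by simpa using hx) v)
    (fun x hx => (hdv x).congr_of_eventuallyEq (hev x hx))
  have hzero : ∀ x ∈ ball (0 : E) R, (1 + fderiv ℝ u x).det = 0 := by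
    intro x hx
    have hkd : Differentiable ℝ k := hk.differentiable one_ne_zero
    have h1 : fderiv ℝ v x = R • fderiv ℝ k x - 1 :=
      (((hkd x).hasFDerivAt.const_smul R).sub (hasFDerivAt_id x)).fderiv
    rw [(hev x hx).fderiv_eq, h1, add_sub_cancel]
    exact det_fderiv_eq_zero_of_norm_eq_one hkd hk1 R x
  rw [setIntegral_congr_fun measurableSet_ball hzero, integral_zero] at hvol
  have : 0 < (Measure.addHaar : Measure E).real (ball 0 R) :=
    ENNReal.toReal_pos (measure_ball_pos _ _ hRpos).ne' measure_ball_lt_top.ne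
  exact this.ne hvol

end NoRetraction

/-! ### Algebra of the dilations -/

section Dilation

variable {d : ℕ}

/-- The dilation `δ_t` as a continuous linear map. -/
def dilationCLM (w : Fin d → ℕ) (t : ℝ) : (Fin d → ℝ) →L[ℝ] (Fin d → ℝ) :=
  ContinuousLinearMap.pi fun i => t ^ w i • ContinuousLinearMap.proj i

theorem dilationCLM_apply (w : Fin d → ℕ) (t : ℝ) (x : Fin d → ℝ) :
    dilationCLM w t x = dilation w t x := rfl

theorem dilation_dilation (w : Fin d → ℕ) (s t : ℝ) (x : Fin d → ℝ) :
    dilation w s (dilation w t x) = dilation w (s * t) x := by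
  funext i
  simp only [dilation, mul_pow, mul_assoc]

theorem dilation_one (w : Fin d → ℕ) (x : Fin d → ℝ) : dilation w 1 x = x := by
  funext i
  simp [dilation]

theorem dilation_inv_dilation (w : Fin d → ℕ) {t : ℝ} (ht : t ≠ 0) (x : Fin d → ℝ) :
    dilation w t⁻¹ (dilation w t x) = x := by
  rw [dilation_dilation, inv_mul_cancel₀ ht, dilation_one]

theorem dilation_dilation_inv (w : Fin d → ℕ) {t : ℝ} (ht : t ≠ 0) (x : Fin d → ℝ) :
    dilation w t (dilation w t⁻¹ x) = x := by
  rw [dilation_dilation, mul_inv_cancel₀ ht, dilation_one]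

theorem dilation_single (w : Fin d → ℕ) (t : ℝ) (i : Fin d) (c : ℝ) :
    dilation w t (Pi.single i c) = t ^ w i • Pi.single i c := by
  funext j
  rcases eq_or_ne j i with rfl | h
  · simp [dilation]
  · simp [dilation, h]

theorem continuous_dilation_left (w : Fin d → ℕ) (x : Fin d → ℝ) :
    Continuous fun t => dilation w t x :=
  continuous_pi fun i => by unfold dilation; fun_prop

theorem continuous_dilation_right (w : Fin d → ℕ) (t : ℝ) : Continuous (dilation w t) :=
  (dilationCLM w t).continuous

end Dilation

/-! ### Left-invariant frame and Lebesgue measure -/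

namespace StratifiedGroup

variable {d : ℕ} (G : StratifiedGroup d)

theorem mul_inv (x : Fin d → ℝ) : G.mul x (G.inv x) = 0 := by
  have h : G.mul (G.inv (G.inv x)) (G.mul (G.inv x) (G.mul x (G.inv x))) = G.mul x (G.inv x) := by
    rw [← G.mul_assoc, G.inv_mul, G.zero_mul]
  rw [← h, ← G.mul_assoc (G.inv x), G.inv_mul, G.zero_mul, G.inv_mul]

theorem inv_mul_cancel_left (y x : Fin d → ℝ) : G.mul (G.inv y) (G.mul y x) = x := by
  rw [← G.mul_assoc, G.inv_mul, G.zero_mul]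

theorem mul_inv_cancel_left (y x : Fin d → ℝ) : G.mul y (G.mul (G.inv y) x) = x := by
  rw [← G.mul_assoc, G.mul_inv, G.zero_mul]

theorem contDiff_mul_left (x : Fin d → ℝ) : ContDiff ℝ ∞ (G.mul x) :=
  G.contDiff_mul.comp (contDiff_const.prodMk contDiff_id)

theorem differentiable_mul_left (x : Fin d → ℝ) : Differentiable ℝ (G.mul x) :=
  (G.contDiff_mul_left x).differentiable (by simp)

/-- The differential at the identity of the left translation by `x`; it maps the `i`-th
coordinate vector to the value at `x` of the left-invariant field `X_i`. -/
def frame (x : Fin d → ℝ) : (Fin d → ℝ) →L[ℝ] (Fin d → ℝ) := fderiv ℝ (G.mul x) 0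

theorem leftField_eq_frame (i : Fin d) (x : Fin d → ℝ) :
    leftField G.mul i x = G.frame x (Pi.single i 1) := rfl

theorem contDiff_frame : ContDiff ℝ ∞ G.frame :=
  ContDiff.fderiv (f := G.mul) (g := fun _ => 0) G.contDiff_mul contDiff_const (by simp)

theorem frame_zero : G.frame 0 = ContinuousLinearMap.id ℝ _ := by
  have : G.mul 0 = id := funext G.zero_mul
  rw [frame, this, fderiv_id]

/-- The frame `x ↦ G.frame x` is invariant under left translations. -/
theorem fderiv_mul_comp_frame (y x : Fin d → ℝ) :
    (fderiv ℝ (G.mul y) x).comp (G.frame x) = G.frame (G.mul y x) := by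
  have h : G.mul (G.mul y x) = G.mul y ∘ G.mul x := funext fun z => G.mul_assoc y x z
  have h0 : DifferentiableAt ℝ (G.mul y) (G.mul x 0) := G.differentiable_mul_left y _
  rw [frame, frame, h, fderiv_comp _ h0 (G.differentiable_mul_left x 0), G.mul_zero]

/-- The dilations map left-invariant fields to left-invariant fields. -/
theorem frame_dilation_comp {t : ℝ} (ht : 0 < t) (x : Fin d → ℝ) :
    (G.frame (dilation G.weight t x)).comp (dilationCLM G.weight t) =
      (dilationCLM G.weight t).comp (G.frame x) := by
  have h : G.mul (dilation G.weight t x) ∘ dilationCLM G.weight t =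
      dilationCLM G.weight t ∘ G.mul x := by
    funext z
    exact (G.dilation_mul t ht x z).symm
  have h1 := congrArg (fun f => fderiv ℝ f 0) h
  rw [fderiv_comp _ (G.differentiable_mul_left _ _) (dilationCLM G.weight t).differentiableAt,
    fderiv_comp _ (dilationCLM G.weight t).differentiableAt (G.differentiable_mul_left x 0),
    ContinuousLinearMap.fderiv, ContinuousLinearMap.fderiv, map_zero] at h1
  exact h1

theorem frame_injective (x : Fin d → ℝ) : Function.Injective (G.frame x) := by
  have h := G.fderiv_mul_comp_frame (G.inv x) x
  rw [G.inv_mul, G.frame_zero] at h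
  exact Function.LeftInverse.injective (g := fderiv ℝ (G.mul (G.inv x)) x) fun v =>
    congrArg (fun f => f v) h

theorem dilationCLM_det_ne_zero (w : Fin d → ℕ) {t : ℝ} (ht : t ≠ 0) :
    (dilationCLM w t).det ≠ 0 := by
  have h : (dilationCLM w t⁻¹).comp (dilationCLM w t) = ContinuousLinearMap.id ℝ _ :=
    ContinuousLinearMap.ext fun x => dilation_inv_dilation w ht x
  have h1 := congrArg ContinuousLinearMap.det h
  intro h0
  have h2 : ((dilationCLM w t⁻¹).comp (dilationCLM w t)).det =
    (dilationCLM w t⁻¹).det * (dilationCLM w t).det := LinearMap.det_comp _ _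
  rw [h2, h0, MulZeroClass.mul_zero] at h1
  simp [ContinuousLinearMap.det] at h1

theorem det_frame_dilation {t : ℝ} (ht : 0 < t) (x : Fin d → ℝ) :
    (G.frame (dilation G.weight t x)).det = (G.frame x).det := by
  have h := congrArg ContinuousLinearMap.det (G.frame_dilation_comp ht x)
  have h1 : ((G.frame (dilation G.weight t x)).comp (dilationCLM G.weight t)).det =
    (G.frame (dilation G.weight t x)).det * (dilationCLM G.weight t).det := LinearMap.det_comp _ _
  have h2 : ((dilationCLM G.weight t).comp (G.frame x)).det =
    (dilationCLM G.weight t).det * (G.frame x).det := LinearMap.det_comp _ _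
  rw [h1, h2, mul_comm] at h
  exact mul_left_cancel₀ (dilationCLM_det_ne_zero G.weight ht.ne') h

theorem dilation_zero_left (x : Fin d → ℝ) : dilation G.weight 0 x = 0 := by
  funext i
  have := G.weight_pos i
  simp [dilation, show G.weight i ≠ 0 by omega]

/-- The determinant is constant along each dilation orbit, and the orbit tends to the identity as `t
→ 0`, where the frame is the identity map. -/
theorem det_frame (x : Fin d → ℝ) : (G.frame x).det = 1 := by
  have hcont : Continuous fun t : ℝ => (G.frame (dilation G.weight t x)).det :=
    ContinuousLinearMap.continuous_det.comp
      (G.contDiff_frame.continuous.comp (continuous_dilation_left G.weight x))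
  have h1 : Filter.Tendsto (fun t : ℝ => (G.frame (dilation G.weight t x)).det)
      (nhdsWithin 0 (Set.Ioi 0)) (nhds 1) := by
    have := hcont.tendsto 0
    rw [G.dilation_zero_left, G.frame_zero] at this
    simpa [ContinuousLinearMap.det] using this.mono_left nhdsWithin_le_nhds
  refine tendsto_nhds_unique (tendsto_const_nhds.congr' ?_) h1
  filter_upwards [self_mem_nhdsWithin] with t ht
  exact (G.det_frame_dilation ht x).symm

theorem det_fderiv_mul (y x : Fin d → ℝ) : (fderiv ℝ (G.mul y) x).det = 1 := by
  have h := congrArg ContinuousLinearMap.det (G.fderiv_mul_comp_frame y x)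
  have h1 : ((fderiv ℝ (G.mul y) x).comp (G.frame x)).det =
    (fderiv ℝ (G.mul y) x).det * (G.frame x).det := LinearMap.det_comp _ _
  rwa [h1, G.det_frame, G.det_frame, mul_one] at h

/-- The Lebesgue measure is left-invariant. -/
theorem volume_image_mul (y : Fin d → ℝ) {s : Set (Fin d → ℝ)} (hs : MeasurableSet s) :
    volume (G.mul y '' s) = volume s := by
  have h := lintegral_abs_det_fderiv_eq_addHaar_image volume hs
    (fun x _ => (G.differentiable_mul_left y x).hasFDerivAt.hasFDerivWithinAt)
    (Function.LeftInverse.injective (G.inv_mul_cancel_left y)).injOn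
  rw [← h]
  simp [G.det_fderiv_mul]

theorem exists_volume_image_mul_dilation (y : Fin d → ℝ) {r : ℝ} (hr : 0 < r) :
    ∃ J : ENNReal, J ≠ 0 ∧ J ≠ ⊤ ∧ ∀ s : Set (Fin d → ℝ), MeasurableSet s →
      volume ((fun k => G.mul y (dilation G.weight r k)) '' s) = J * volume s := by
  refine ⟨ENNReal.ofReal |(dilationCLM G.weight r).det|, ?_, ENNReal.ofReal_ne_top, ?_⟩
  · rw [Ne, ENNReal.ofReal_eq_zero, not_le]
    exact abs_pos.2 (dilationCLM_det_ne_zero _ hr.ne')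
  · intro s hs
    have hm : MeasurableSet (dilation G.weight r '' s) := by
      have : dilation G.weight r '' s = dilation G.weight r⁻¹ ⁻¹' s :=
        congrFun (Set.image_eq_preimage_of_inverse (dilation_inv_dilation _ hr.ne')
          (dilation_dilation_inv _ hr.ne')) s
      rw [this]
      exact (continuous_dilation_right _ _).measurable hs
    rw [← Function.comp_def (G.mul y), Set.image_comp, G.volume_image_mul y hm]
    exact Measure.addHaar_image_continuousLinearMap volume (dilationCLM G.weight r) s

/-- In a non-commutative stratified group, some coordinate lies above the first layer. -/
theorem Noncommutative.exists_weight_ne_one {G : StratifiedGroup d} (hG : G.Noncommutative) :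
    ∃ j, G.weight j ≠ 1 := by
  by_contra! hw
  have hdil : ∀ t x, dilation G.weight t x = t • x := by
    intro t x
    funext i
    simp [dilation, hw]
  set f := fun z : (Fin d → ℝ) × (Fin d → ℝ) => G.mul z.1 z.2
  have hf : HasFDerivAt f (fderiv ℝ f 0) 0 :=
    (G.contDiff_mul.differentiable (by simp) 0).hasFDerivAt
  -- If all weights are one, the product is homogeneous of degree one and differentiable at `0`,
  -- hence linear. The comparison of derivatives is one-sided because only `t > 0` gives an
  -- automorphism.
  have hlin : ∀ z, f z = fderiv ℝ f 0 z := by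
    intro z
    have h1 : HasDerivAt (fun t : ℝ => f (t • z)) (fderiv ℝ f 0 z) 0 := by
      have hl : HasDerivAt (fun t : ℝ => t • z) z 0 := by
        simpa using (hasDerivAt_id (0 : ℝ)).smul_const z
      have hf' : HasFDerivAt f (fderiv ℝ f 0) ((0 : ℝ) • z) := by rwa [zero_smul]
      exact hf'.comp_hasDerivAt 0 hl
    have h2 : HasDerivWithinAt (fun t : ℝ => f (t • z)) (f z) (Set.Ici 0) 0 := by
      have hl : HasDerivAt (fun t : ℝ => t • f z) (f z) 0 := by
        simpa using (hasDerivAt_id (0 : ℝ)).smul_const (f z)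
      refine hl.hasDerivWithinAt.congr (fun t ht => ?_) ?_
      · rcases (Set.mem_Ici.1 ht).eq_or_lt with rfl | ht
        · simp [f, G.mul_zero]
        · have := G.dilation_mul t ht z.1 z.2
          rw [hdil, hdil, hdil] at this
          exact this.symm
      · simp [f, G.mul_zero]
    exact (uniqueDiffOn_Ici (0 : ℝ) 0 Set.self_mem_Ici).eq_deriv _ h2 h1.hasDerivWithinAt
  have hadd : ∀ x y, G.mul x y = x + y := by
    intro x y
    have h : G.mul x y = f ((x, 0) + (0, y)) := by simp [f]
    rw [h, hlin, map_add, ← hlin, ← hlin]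
    simp [f, G.mul_zero, G.zero_mul]
  obtain ⟨x, y, hxy⟩ := hG
  exact hxy (by rw [hadd, hadd, add_comm])

end StratifiedGroup

/-- The space `Fin d → ℝ` carries the sup norm, so the result for inner product spaces is
transported from `EuclideanSpace`. -/
theorem exists_eq_zero_of_eq_id_off_compact {d : ℕ} {g : (Fin d → ℝ) → (Fin d → ℝ)}
    (hg : ContDiff ℝ 1 g) {R : ℝ} (hR : ∀ x, R ≤ ‖x‖ → g x = x) : ∃ x, g x = 0 := by
  let e := EuclideanSpace.equiv (Fin d) ℝ
  set K := ‖(e.symm : (Fin d → ℝ) →L[ℝ] EuclideanSpace ℝ (Fin d))‖ + 1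
  have hK : 0 < K := by positivity
  have hg' : ContDiff ℝ 1 (fun z => e.symm (g (e z))) :=
    e.symm.contDiff.comp (hg.comp e.contDiff)
  obtain ⟨z, hz⟩ := exists_eq_zero_of_eq_id_off_ball hg' (r := K * R) fun z hz => by
    have h1 : ‖z‖ ≤ K * ‖e z‖ := by
      have := (e.symm : (Fin d → ℝ) →L[ℝ] EuclideanSpace ℝ (Fin d)).le_opNorm (e z)
      simp only [ContinuousLinearEquiv.coe_coe, ContinuousLinearEquiv.symm_apply_apply] at this
      exact this.trans (mul_le_mul_of_nonneg_right (by simp [K]) (norm_nonneg _))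
    rw [hR _ (le_of_mul_le_mul_left (hz.trans h1) hK), e.symm_apply_apply]
  exact ⟨e z, by simpa using hz⟩

/-! ### Horizontal critical points of a homogeneous norm -/

namespace StratifiedGroup

variable {d : ℕ} {G : StratifiedGroup d} {N : (Fin d → ℝ) → ℝ}

namespace IsSmoothHomogeneousNorm

theorem pos (hN : G.IsSmoothHomogeneousNorm N) {x : Fin d → ℝ} (hx : x ≠ 0) : 0 < N x :=
  (hN.nonneg x).lt_of_ne fun h => hx ((hN.eq_zero_iff x).1 h.symm)

theorem contDiffAt (hN : G.IsSmoothHomogeneousNorm N) {x : Fin d → ℝ} (hx : x ≠ 0) :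
    ContDiffAt ℝ ∞ N x :=
  hN.smooth.contDiffAt (isOpen_compl_singleton.mem_nhds hx)

theorem differentiableAt (hN : G.IsSmoothHomogeneousNorm N) {x : Fin d → ℝ} (hx : x ≠ 0) :
    DifferentiableAt ℝ N x :=
  (hN.contDiffAt hx).differentiableAt (by simp)

/-- Euler's identity. -/
theorem fderiv_euler (hN : G.IsSmoothHomogeneousNorm N) {x : Fin d → ℝ} (hx : x ≠ 0) :
    fderiv ℝ N x (fun i => (G.weight i : ℝ) * x i) = N x := by
  have hdil : HasDerivAt (fun t : ℝ => dilation G.weight t x)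
      (fun i => (G.weight i : ℝ) * x i) 1 := by
    rw [hasDerivAt_pi]
    intro i
    have h := (hasDerivAt_pow (G.weight i) (1 : ℝ)).mul_const (x i)
    rw [one_pow, mul_one] at h
    exact h
  have hd : HasFDerivAt N (fderiv ℝ N x) (dilation G.weight 1 x) := by
    rw [dilation_one]
    exact (hN.differentiableAt hx).hasFDerivAt
  have h1 := hd.comp_hasDerivAt 1 hdil
  have h2 : HasDerivAt (fun t : ℝ => t * N x) (N x) 1 := by
    simpa using (hasDerivAt_id (1 : ℝ)).mul_const (N x)
  refine h1.unique (h2.congr_of_eventuallyEq ?_)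
  filter_upwards [lt_mem_nhds (zero_lt_one : (0 : ℝ) < 1)] with t ht
  exact hN.homogeneous t ht x

/-- A smooth homogeneous norm on a non-commutative stratified group has a point, other than the
identity, where its sub-gradient vanishes. -/
theorem exists_horizontal_critical_point (hN : G.IsSmoothHomogeneousNorm N)
    (hG : G.Noncommutative) :
    ∃ x, x ≠ 0 ∧ ∀ i, G.weight i = 1 → fderiv ℝ N x (leftField G.mul i x) = 0 := by
  obtain ⟨j, hj⟩ := hG.exists_weight_ne_one
  let b : ContDiffBump (0 : Fin d → ℝ) := ⟨1, 2, by norm_num, by norm_num⟩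
  let s : ContDiffBump (0 : Fin d → ℝ) := ⟨2, 3, by norm_num, by norm_num⟩
  let F : (Fin d → ℝ) → (Fin d → ℝ) := fun x i =>
    if G.weight i = 1 then fderiv ℝ N x (leftField G.mul i x) else 0
  let P : (Fin d → ℝ) → (Fin d → ℝ) := fun x => (1 - b x) • F x + b x • Pi.single j 1
  -- The cutoff `s` is `1` wherever `b ≠ 0`, so the two interpolations do not interfere.
  let W : (Fin d → ℝ) → (Fin d → ℝ) := fun x =>
    (1 - s x) • (fun i => (G.weight i : ℝ) * x i) + s x • G.frame x (P x)
  have hw : ∀ i, (G.weight i : ℝ) ≠ 0 := fun i => by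
    have := G.weight_pos i
    exact_mod_cast (by omega : G.weight i ≠ 0)
  have hF : ∀ x, x ≠ 0 → ContDiffAt ℝ 1 F x := by
    intro x hx
    rw [contDiffAt_pi]
    intro i
    by_cases hi : G.weight i = 1
    · simp only [F, hi, if_true]
      have h1 : ContDiffAt ℝ 1 (fderiv ℝ N) x :=
        (hN.contDiffAt hx).fderiv_right (by norm_cast)
      have h2 : ContDiffAt ℝ 1 (fun x => leftField G.mul i x) x :=
        ((G.contDiff_frame.of_le (by norm_cast)).clm_apply
          contDiff_const).contDiffAt
      exact h1.clm_apply h2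
    · simp only [F, hi, if_false]
      exact contDiffAt_const
  have hb : ContDiff ℝ 1 b := b.contDiff
  have hs : ContDiff ℝ 1 s := s.contDiff
  have hP : ContDiff ℝ 1 P := by
    rw [contDiff_iff_contDiffAt]
    intro x
    rcases eq_or_ne x 0 with rfl | hx
    -- The possible singularity of `N` at `0` is harmless, since `b = 1` nearby.
    · refine (contDiffAt_const (c := Pi.single j (1 : ℝ))).congr_of_eventuallyEq ?_
      filter_upwards [b.eventuallyEq_one] with x hx
      simp [P, hx]
    · exact ((contDiffAt_const.sub hb.contDiffAt).smul (hF x hx)).add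
        (hb.contDiffAt.smul contDiffAt_const)
  have hE : ContDiff ℝ 1 fun (x : Fin d → ℝ) i => (G.weight i : ℝ) * x i :=
    contDiff_pi.2 fun i => contDiff_const.mul (contDiff_apply ℝ ℝ i)
  have hW : ContDiff ℝ 1 W :=
    ((contDiff_const.sub hs).smul hE).add (hs.smul
      ((G.contDiff_frame.of_le (by norm_cast)).clm_apply hP))
  -- Dividing each coordinate by its weight turns the Euler field into the identity.
  obtain ⟨x, hx⟩ := exists_eq_zero_of_eq_id_off_compact
    (g := fun x i => (G.weight i : ℝ)⁻¹ * W x i) (R := 3)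
    (contDiff_pi.2 fun i => contDiff_const.mul (contDiff_pi.1 hW i)) fun x hx => by
      have h0 : s x = 0 := s.zero_of_le_dist (by simpa [s] using hx)
      funext i
      simp [W, h0, inv_mul_cancel_left₀ (hw i)]
  have hWx : W x = 0 := by
    funext i
    have := congrFun hx i
    simpa [hw i] using this
  suffices h : x ≠ 0 ∧ F x = 0 by
    refine ⟨x, h.1, fun i hi => ?_⟩
    simpa [F, hi] using congrFun h.2 i
  rcases le_or_gt ‖x‖ 2 with h2 | h2
  · have h1 : s x = 1 := s.one_of_mem_closedBall (by simpa [s] using h2)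
    have hPx : P x = 0 := by
      refine G.frame_injective x ?_
      rw [map_zero]
      simpa [W, h1] using hWx
    -- The `j`-th coordinate of `F` is zero because `j` is not in the first layer, so that of `P x`
    -- is `b x`.
    have hbx : b x = 0 := by simpa [P, F, hj] using congrFun hPx j
    refine ⟨?_, by simpa [P, hbx] using hPx⟩
    rintro rfl
    have : b 0 = 1 := b.one_of_mem_closedBall (by simp [b])
    rw [hbx] at this
    exact zero_ne_one this
  · have hx0 : x ≠ 0 := by
      rintro rfl
      rw [norm_zero] at h2
      linarith
    refine ⟨hx0, ?_⟩
    have hbx : b x = 0 := b.zero_of_le_dist (by simpa [b] using h2.le)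
    have hPx : P x = F x := by simp [P, hbx]
    have hsum : fderiv ℝ N x (G.frame x (F x)) = ∑ i, F x i ^ 2 := by
      have : F x = ∑ i, F x i • Pi.single i (1 : ℝ) := pi_eq_sum_univ' (F x)
      conv_lhs => rw [this]
      rw [map_sum, map_sum]
      refine Finset.sum_congr rfl fun i _ => ?_
      rw [map_smul, map_smul, ← leftField_eq_frame]
      by_cases hi : G.weight i = 1 <;> simp [F, hi, sq]
    -- Applying `dN` to `W x = 0` gives `(1 - s) N + s |F|² = 0`, a sum of nonnegative terms.
    have h0 := congrArg (fderiv ℝ N x) hWx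
    simp only [W, hPx, map_add, map_smul, hN.fderiv_euler hx0, hsum, map_zero, smul_eq_mul] at h0
    have hq : 0 ≤ ∑ i, F x i ^ 2 := Finset.sum_nonneg fun i _ => sq_nonneg _
    have hNx := hN.pos hx0
    have hs0 : 0 ≤ s x := s.nonneg
    have hs1 : s x ≤ 1 := s.le_one
    have h3 : (1 - s x) * N x = 0 := by
      nlinarith [mul_nonneg (sub_nonneg.2 hs1) hNx.le, mul_nonneg hs0 hq]
    have h4 : s x = 1 := by
      rcases mul_eq_zero.1 h3 with h | h
      · linarith
      · exact absurd h hNx.ne'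
    rw [h4, sub_self, MulZeroClass.zero_mul, zero_add, one_mul] at h0
    funext i
    have := (Finset.sum_eq_zero_iff_of_nonneg fun i _ => sq_nonneg _).1 h0 i (Finset.mem_univ i)
    simpa using this

end IsSmoothHomogeneousNorm
end StratifiedGroup

/-! ### Integrability and mass bounds for the Gibbs measure -/

namespace StratifiedGroup.IsSmoothHomogeneousNorm

variable {d : ℕ} {G : StratifiedGroup d} {N : (Fin d → ℝ) → ℝ}

theorem exists_le_of_norm_eq_one (hN : G.IsSmoothHomogeneousNorm N) :
    ∃ c > 0, ∀ y, ‖y‖ = 1 → c ≤ N y := by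
  rcases (Metric.sphere (0 : Fin d → ℝ) 1).eq_empty_or_nonempty with h | h
  · refine ⟨1, one_pos, fun y hy => ?_⟩
    have : y ∈ Metric.sphere (0 : Fin d → ℝ) 1 := by simpa using hy
    rw [h] at this
    exact this.elim
  · obtain ⟨z, hz, hmin⟩ := (isCompact_sphere (0 : Fin d → ℝ) 1).exists_isMinOn h
      hN.continuous.continuousOn
    refine ⟨N z, hN.pos ?_, fun y hy => hmin (by simpa using hy)⟩
    rintro rfl
    simp at hz

/-- Each point of norm at least one is dilated back to the unit sphere, where `N` has a positive
minimum. The sum of the weights is a crude exponent that dominates each of them. -/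
theorem exists_lower_bound (hN : G.IsSmoothHomogeneousNorm N) :
    ∃ c > 0, ∃ W : ℕ, ∀ x, 1 ≤ ‖x‖ → ∃ t : ℝ, 1 ≤ t ∧ ‖x‖ ≤ t ^ W ∧ c * t ≤ N x := by
  obtain ⟨c, hc, hcN⟩ := hN.exists_le_of_norm_eq_one
  refine ⟨c, hc, ∑ i, G.weight i, fun x hx => ?_⟩
  have hcont : ContinuousOn (fun s : ℝ => ‖dilation G.weight s x‖) (Set.Icc 0 1) :=
    (continuous_dilation_left G.weight x).norm.continuousOn
  obtain ⟨s, hs, hs1⟩ := intermediate_value_Icc zero_le_one hcont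
    (show (1 : ℝ) ∈ _ by
      rw [G.dilation_zero_left, dilation_one, norm_zero]
      exact ⟨zero_le_one, hx⟩)
  simp only at hs1
  have hs0 : 0 < s := by
    refine hs.1.lt_of_ne ?_
    rintro rfl
    rw [G.dilation_zero_left, norm_zero] at hs1
    exact zero_ne_one hs1
  have ht1 : 1 ≤ s⁻¹ := (one_le_inv₀ hs0).2 hs.2
  have hx' := dilation_inv_dilation G.weight hs0.ne' x
  refine ⟨s⁻¹, ht1, ?_, ?_⟩
  · rw [pi_norm_le_iff_of_nonneg (by positivity)]
    intro i
    rw [← hx', dilation, norm_mul, Real.norm_of_nonneg (by positivity)]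
    calc s⁻¹ ^ G.weight i * ‖dilation G.weight s x i‖ ≤ s⁻¹ ^ G.weight i * 1 := by
          gcongr
          exact hs1 ▸ norm_le_pi_norm _ i
      _ ≤ s⁻¹ ^ ∑ i, G.weight i := by
          rw [mul_one]
          exact pow_le_pow_right₀ ht1
            (Finset.single_le_sum (f := G.weight) (fun _ _ => Nat.zero_le _) (Finset.mem_univ i))
  · rw [← hx', hN.homogeneous _ (by positivity), mul_comm c]
    exact mul_le_mul_of_nonneg_left (hcN _ hs1) (by positivity)

theorem integrable_exp (hN : G.IsSmoothHomogeneousNorm N) {α p : ℝ} (hα : 0 < α) (hp : 1 ≤ p) :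
    Integrable fun x => Real.exp (-α * N x ^ p) := by
  obtain ⟨c, hc, W, hW⟩ := hN.exists_lower_bound
  have hint : Integrable fun x : Fin d → ℝ => (1 + ‖x‖) ^ (-((d : ℝ) + 1)) :=
    integrable_one_add_norm (by simp)
  -- This power of `t` dominates `(1 + ‖x‖) ^ (d + 1)` up to a constant; the Taylor term of order
  -- `n` of the exponential absorbs it.
  set n := W * (d + 1)
  set A := α * c ^ p
  have hA : 0 < A := by positivity
  set K : ℝ := 2 ^ (d + 1) * max 1 (n.factorial / A ^ n)
  refine (hint.const_mul K).mono' ?_ (Filter.Eventually.of_forall fun x => ?_)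
  · exact (Real.continuous_exp.comp (continuous_const.mul
      (hN.continuous.rpow_const fun x => Or.inr (by linarith)))).aestronglyMeasurable
  have hpow : (1 + ‖x‖) ^ (-((d : ℝ) + 1)) = ((1 + ‖x‖) ^ (d + 1))⁻¹ := by
    rw [Real.rpow_neg (by positivity)]
    norm_cast
  rw [Real.norm_of_nonneg (Real.exp_pos _).le, hpow, ← div_eq_mul_inv, le_div_iff₀ (by positivity)]
  rcases le_total 1 ‖x‖ with hx | hx
  · obtain ⟨t, ht, hxt, hNt⟩ := hW x hx
    have h1 : A * t ≤ α * N x ^ p := by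
      calc A * t = α * (c ^ p * t ^ (1 : ℝ)) := by rw [Real.rpow_one, _root_.mul_assoc]
        _ ≤ α * (c ^ p * t ^ p) := by gcongr
        _ = α * (c * t) ^ p := by rw [Real.mul_rpow hc.le (by linarith)]
        _ ≤ α * N x ^ p := by gcongr
    have h2 : Real.exp (-α * N x ^ p) ≤ n.factorial / A ^ n / t ^ n := by
      have h3 := Real.pow_div_factorial_le_exp (A * t) (by positivity) n
      rw [div_le_iff₀ (by positivity), mul_pow] at h3
      rw [div_div, le_div_iff₀ (by positivity)]
      calc Real.exp (-α * N x ^ p) * (A ^ n * t ^ n)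
          ≤ Real.exp (-(A * t)) * (Real.exp (A * t) * n.factorial) := by
            gcongr
            linarith
        _ = n.factorial := by rw [← _root_.mul_assoc, ← Real.exp_add]; simp
    have h4 : (1 + ‖x‖) ^ (d + 1) ≤ 2 ^ (d + 1) * t ^ n := by
      calc (1 + ‖x‖) ^ (d + 1) ≤ (2 * t ^ W) ^ (d + 1) := by
            gcongr
            linarith
        _ = 2 ^ (d + 1) * t ^ n := by rw [mul_pow, ← pow_mul]
    calc Real.exp (-α * N x ^ p) * (1 + ‖x‖) ^ (d + 1)
        ≤ n.factorial / A ^ n / t ^ n * (2 ^ (d + 1) * t ^ n) := by gcongr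
      _ = 2 ^ (d + 1) * (n.factorial / A ^ n) := by
          have : t ^ n ≠ 0 := by positivity
          field_simp
      _ ≤ K := by
          exact mul_le_mul_of_nonneg_left (le_max_right _ _) (by positivity)
  · have h1 : Real.exp (-α * N x ^ p) ≤ 1 := by
      rw [Real.exp_le_one_iff]
      have := Real.rpow_nonneg (hN.nonneg x) p
      nlinarith
    have h2 : (1 + ‖x‖) ^ (d + 1) ≤ 2 ^ (d + 1) := by
      gcongr
      linarith
    calc Real.exp (-α * N x ^ p) * (1 + ‖x‖) ^ (d + 1) ≤ 1 * 2 ^ (d + 1) := by gcongr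
      _ ≤ K := by
          rw [one_mul]
          exact le_mul_of_one_le_right (by positivity) (le_max_left _ _)

theorem gibbsMeasure_apply (hN : G.IsSmoothHomogeneousNorm N) {α p : ℝ} (hα : 0 < α) (hp : 1 ≤ p)
    {s : Set (Fin d → ℝ)} (hs : MeasurableSet s) :
    gibbsMeasure N α p s = ENNReal.ofReal
      ((∫ x, Real.exp (-α * N x ^ p))⁻¹ * ∫ x in s, Real.exp (-α * N x ^ p)) := by
  have hi := hN.integrable_exp hα hp
  have hpos : 0 < ∫ x, Real.exp (-α * N x ^ p) := integral_exp_pos hi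
  rw [gibbsMeasure, Measure.smul_apply, withDensity_apply _ hs, smul_eq_mul,
    ← ofReal_integral_eq_lintegral_ofReal hi (Filter.Eventually.of_forall fun x => by positivity),
    ← ofReal_integral_eq_lintegral_ofReal hi.integrableOn
      (Filter.Eventually.of_forall fun x => by positivity),
    ENNReal.ofReal_mul (by positivity), ENNReal.ofReal_inv_of_pos hpos]

theorem isProbabilityMeasure_gibbsMeasure (hN : G.IsSmoothHomogeneousNorm N) {α p : ℝ}
    (hα : 0 < α) (hp : 1 ≤ p) : IsProbabilityMeasure (gibbsMeasure N α p) := by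
  have hpos : 0 < ∫ x, Real.exp (-α * N x ^ p) := integral_exp_pos (hN.integrable_exp hα hp)
  refine ⟨?_⟩
  rw [hN.gibbsMeasure_apply hα hp MeasurableSet.univ, Measure.restrict_univ,
    inv_mul_cancel₀ hpos.ne', ENNReal.ofReal_one]

theorem gibbsMeasure_real (hN : G.IsSmoothHomogeneousNorm N) {α p : ℝ} (hα : 0 < α) (hp : 1 ≤ p)
    {s : Set (Fin d → ℝ)} (hs : MeasurableSet s) :
    (gibbsMeasure N α p).real s =
      (∫ x, Real.exp (-α * N x ^ p))⁻¹ * ∫ x in s, Real.exp (-α * N x ^ p) := by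
  rw [Measure.real, hN.gibbsMeasure_apply hα hp hs, ENNReal.toReal_ofReal]
  have := integral_exp_pos (hN.integrable_exp hα hp)
  have : 0 ≤ ∫ x in s, Real.exp (-α * N x ^ p) :=
    setIntegral_nonneg hs fun x _ => (Real.exp_pos _).le
  positivity

theorem gibbsMeasure_real_le (hN : G.IsSmoothHomogeneousNorm N) {α p : ℝ} (hα : 0 < α)
    (hp : 1 ≤ p) {s : Set (Fin d → ℝ)} (hs : MeasurableSet s) (hv : volume s ≠ ⊤) {c : ℝ}
    (h : ∀ x ∈ s, c ≤ α * N x ^ p) :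
    (gibbsMeasure N α p).real s ≤
      (∫ x, Real.exp (-α * N x ^ p))⁻¹ * (Real.exp (-c) * volume.real s) := by
  have hi := hN.integrable_exp hα hp
  have := integral_exp_pos hi
  rw [hN.gibbsMeasure_real hα hp hs]
  gcongr
  calc ∫ x in s, Real.exp (-α * N x ^ p) ≤ ∫ _ in s, Real.exp (-c) :=
        setIntegral_mono_on hi.integrableOn (integrableOn_const hv) hs fun x hx =>
          Real.exp_le_exp.2 (by linarith [h x hx])
    _ = Real.exp (-c) * volume.real s := by rw [setIntegral_const, smul_eq_mul, mul_comm]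

theorem le_gibbsMeasure_real (hN : G.IsSmoothHomogeneousNorm N) {α p : ℝ} (hα : 0 < α)
    (hp : 1 ≤ p) {s : Set (Fin d → ℝ)} (hs : MeasurableSet s) (hv : volume s ≠ ⊤) {c : ℝ}
    (h : ∀ x ∈ s, α * N x ^ p ≤ c) :
    (∫ x, Real.exp (-α * N x ^ p))⁻¹ * (Real.exp (-c) * volume.real s) ≤
      (gibbsMeasure N α p).real s := by
  have hi := hN.integrable_exp hα hp
  have := integral_exp_pos hi
  rw [hN.gibbsMeasure_real hα hp hs]
  gcongr
  calc Real.exp (-c) * volume.real s = ∫ _ in s, Real.exp (-c) := by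
        rw [setIntegral_const, smul_eq_mul, mul_comm]
    _ ≤ ∫ x in s, Real.exp (-α * N x ^ p) :=
        setIntegral_mono_on (integrableOn_const hv) hi.integrableOn hs fun x hx =>
          Real.exp_le_exp.2 (by linarith [h x hx])

/-- The Gibbs measure of a set far away decays like `e ^ (-c / 2)`, whatever its volume. -/
theorem exists_gibbsMeasure_real_le_exp (hN : G.IsSmoothHomogeneousNorm N) {α p : ℝ} (hα : 0 < α)
    (hp : 1 ≤ p) : ∃ L : ℝ, ∀ (s : Set (Fin d → ℝ)) (c : ℝ), MeasurableSet s →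
      (∀ x ∈ s, c ≤ α * N x ^ p) → (gibbsMeasure N α p).real s ≤ Real.exp (L - c / 2) := by
  have hi := hN.integrable_exp hα hp
  have hi2 := hN.integrable_exp (half_pos hα) hp
  have h1 := integral_exp_pos hi
  have h2 := integral_exp_pos hi2
  -- Half of the exponent yields `e ^ (-c / 2)`; the other half is still integrable over the whole
  -- space.
  refine ⟨Real.log ((∫ x, Real.exp (-α * N x ^ p))⁻¹ * ∫ x, Real.exp (-(α / 2) * N x ^ p)),
    fun s c hs h => ?_⟩
  rw [sub_eq_add_neg, Real.exp_add, Real.exp_log (by positivity), hN.gibbsMeasure_real hα hp hs,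
    _root_.mul_assoc]
  gcongr
  calc ∫ x in s, Real.exp (-α * N x ^ p)
      ≤ ∫ x in s, Real.exp (-(α / 2) * N x ^ p) * Real.exp (-(c / 2)) := by
        refine setIntegral_mono_on hi.integrableOn (hi2.mul_const _).integrableOn hs fun x hx => ?_
        rw [← Real.exp_add]
        exact Real.exp_le_exp.2 (by linarith [h x hx])
    _ ≤ ∫ x, Real.exp (-(α / 2) * N x ^ p) * Real.exp (-(c / 2)) :=
        setIntegral_le_integral (hi2.mul_const _)
          (Filter.Eventually.of_forall fun x => by positivity)
    _ = _ := integral_mul_const _ _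

end StratifiedGroup.IsSmoothHomogeneousNorm

/-! ### Second-order expansion under anisotropic dilations -/

section Taylor

variable {d : ℕ}

/-- The derivative differs from its value at `0` by `O(‖y‖)`, and the mean value inequality on the
ball of radius `‖z‖` supplies the second factor. -/
theorem exists_taylor_bound {E : Type*} [NormedAddCommGroup E] [NormedSpace ℝ E] {f : E → ℝ}
    (hf : ContDiffAt ℝ 2 f 0) : ∃ C ≥ 0, ∃ δ > 0, ∀ z, ‖z‖ < δ →
      |f z - f 0 - fderiv ℝ f 0 z| ≤ C * ‖z‖ ^ 2 := by
  have hd1 : ContDiffAt ℝ 1 (fderiv ℝ f) 0 := hf.fderiv_right (by norm_num)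
  obtain ⟨C, hC, hO⟩ := ((hd1.differentiableAt one_ne_zero).isBigO_sub).exists_pos
  have hdiff : ∀ᶠ z in nhds (0 : E), DifferentiableAt ℝ f z := by
    filter_upwards [hf.eventually (by simp)] with z hz using hz.differentiableAt (by simp)
  obtain ⟨δ, hδ, h⟩ := Metric.eventually_nhds_iff.1 (hO.bound.and hdiff)
  refine ⟨C, hC.le, δ, hδ, fun z hz => ?_⟩
  have hball : ∀ y ∈ Metric.closedBall (0 : E) ‖z‖, dist y 0 < δ := fun y hy =>
    lt_of_le_of_lt hy hz
  have key := Convex.norm_image_sub_le_of_norm_hasFDerivWithin_le' (𝕜 := ℝ) (f := f)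
    (f' := fderiv ℝ f) (φ := fderiv ℝ f 0) (s := Metric.closedBall 0 ‖z‖) (C := C * ‖z‖)
    (x := 0) (y := z) (fun y hy => (h (hball y hy)).2.hasFDerivAt.hasFDerivWithinAt)
    (fun y hy => (h (hball y hy)).1.trans (mul_le_mul_of_nonneg_left (by simpa using hy) hC.le))
    (convex_closedBall _ _) (by simp) (by simp)
  simpa [sq, mul_assoc] using key

theorem norm_dilation_le {w : Fin d → ℕ} (hw : ∀ i, 1 ≤ w i) {ε : ℝ} (h0 : 0 ≤ ε) (h1 : ε ≤ 1)
    (k : Fin d → ℝ) : ‖dilation w ε k‖ ≤ ε * ‖k‖ := by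
  rw [pi_norm_le_iff_of_nonneg (by positivity)]
  intro i
  rw [dilation, norm_mul, norm_pow, Real.norm_of_nonneg h0]
  gcongr
  · exact pow_le_of_le_one h0 h1 (by have := hw i; omega)
  · exact norm_le_pi_norm k i

/-- A function whose derivative at the identity vanishes on the first layer varies
quadratically under the dilations. -/
theorem exists_dilation_quadratic_bound {w : Fin d → ℕ} (hw : ∀ i, 1 ≤ w i)
    {f : (Fin d → ℝ) → ℝ} (hf : ContDiffAt ℝ 2 f 0)
    (h : ∀ i, w i = 1 → fderiv ℝ f 0 (Pi.single i 1) = 0) (R : ℝ) :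
    ∃ C, ∃ ε₀ > 0, ∀ ε, 0 < ε → ε < ε₀ → ∀ k, ‖k‖ ≤ R →
      |f (dilation w ε k) - f 0| ≤ C * ε ^ 2 := by
  obtain ⟨C, hC, δ, hδ, hT⟩ := exists_taylor_bound hf
  refine ⟨C * R ^ 2 + ∑ i, |fderiv ℝ f 0 (Pi.single i 1)| * R, min 1 (δ / (|R| + 1)),
    by positivity, fun ε h0 hε k hk => ?_⟩
  have h1 : ε ≤ 1 := hε.le.trans (min_le_left _ _)
  have h2 : ε * (|R| + 1) < δ := (lt_div_iff₀ (by positivity)).1 (hε.trans_le (min_le_right _ _))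
  have hn : ‖dilation w ε k‖ ≤ ε * R :=
    (norm_dilation_le hw h0.le h1 k).trans (by gcongr)
  have hlt : ‖dilation w ε k‖ < δ := by
    refine hn.trans_lt (lt_of_le_of_lt ?_ h2)
    gcongr
    linarith [le_abs_self R]
  have hq := hT _ hlt
  have hlin : |fderiv ℝ f 0 (dilation w ε k)| ≤
      (∑ i, |fderiv ℝ f 0 (Pi.single i 1)| * R) * ε ^ 2 := by
    have hs : dilation w ε k = ∑ i, dilation w ε k i • Pi.single i (1 : ℝ) := pi_eq_sum_univ' _
    rw [hs, map_sum, Finset.sum_mul]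
    refine (Finset.abs_sum_le_sum_abs _ _).trans (Finset.sum_le_sum fun i _ => ?_)
    rw [map_smul, smul_eq_mul, abs_mul]
    by_cases hi : w i = 1
    · simp [h i hi]
    -- Off the first layer the weight is at least two, and `ε ≤ 1`.
    · have h3 : |dilation w ε k i| ≤ ε ^ 2 * R := by
        rw [dilation, abs_mul, abs_pow, abs_of_pos h0]
        exact mul_le_mul (pow_le_pow_of_le_one h0.le h1 (by have := hw i; omega))
          ((norm_le_pi_norm k i).trans hk) (abs_nonneg _) (by positivity)
      calc |dilation w ε k i| * |fderiv ℝ f 0 (Pi.single i 1)|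
          ≤ ε ^ 2 * R * |fderiv ℝ f 0 (Pi.single i 1)| := by gcongr
        _ = _ := by ring
  have hsq : C * ‖dilation w ε k‖ ^ 2 ≤ C * R ^ 2 * ε ^ 2 := by
    calc C * ‖dilation w ε k‖ ^ 2 ≤ C * (ε * R) ^ 2 := by gcongr
      _ = C * R ^ 2 * ε ^ 2 := by ring
  rw [add_mul]
  calc |f (dilation w ε k) - f 0|
      = |(f (dilation w ε k) - f 0 - fderiv ℝ f 0 (dilation w ε k)) +
          fderiv ℝ f 0 (dilation w ε k)| := by ring_nf
    _ ≤ _ := (abs_add_le _ _).trans (add_le_add (hq.trans hsq) hlin)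

end Taylor

/-! ### Rescaled cutoff functions -/

namespace StratifiedGroup

variable {d : ℕ} (G : StratifiedGroup d)

/-- The map `x ↦ δ_{1/r}(y⁻¹ x)`, which carries the set `y δ_r(s)` onto `s`. -/
def rescale (y : Fin d → ℝ) (r : ℝ) (x : Fin d → ℝ) : Fin d → ℝ :=
  dilation G.weight r⁻¹ (G.mul (G.inv y) x)

theorem contDiff_rescale (y : Fin d → ℝ) (r : ℝ) : ContDiff ℝ ∞ (G.rescale y r) :=
  (dilationCLM G.weight r⁻¹).contDiff.comp (G.contDiff_mul_left _)

theorem rescale_mul_dilation (y : Fin d → ℝ) {r : ℝ} (hr : r ≠ 0) (k : Fin d → ℝ) :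
    G.rescale y r (G.mul y (dilation G.weight r k)) = k := by
  rw [rescale, G.inv_mul_cancel_left, dilation_inv_dilation _ hr]

theorem mul_dilation_rescale (y : Fin d → ℝ) {r : ℝ} (hr : r ≠ 0) (x : Fin d → ℝ) :
    G.mul y (dilation G.weight r (G.rescale y r x)) = x := by
  rw [rescale, dilation_dilation_inv _ hr, G.mul_inv_cancel_left]

theorem image_mul_dilation_eq_preimage (y : Fin d → ℝ) {r : ℝ} (hr : r ≠ 0)
    (s : Set (Fin d → ℝ)) :
    (fun k => G.mul y (dilation G.weight r k)) '' s = G.rescale y r ⁻¹' s :=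
  congrFun (Set.image_eq_preimage_of_inverse (G.rescale_mul_dilation y hr)
    (G.mul_dilation_rescale y hr)) s

theorem exists_volume_rescale_preimage (y : Fin d → ℝ) {r : ℝ} (hr : 0 < r) :
    ∃ J : ENNReal, J ≠ 0 ∧ J ≠ ⊤ ∧ ∀ s : Set (Fin d → ℝ), MeasurableSet s →
      volume (G.rescale y r ⁻¹' s) = J * volume s := by
  obtain ⟨J, h0, h1, h⟩ := G.exists_volume_image_mul_dilation y hr
  exact ⟨J, h0, h1, fun s hs => by rw [← h s hs, G.image_mul_dilation_eq_preimage y hr.ne']⟩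

/-- The first-layer fields are left-invariant and homogeneous of degree one. -/
theorem fderiv_comp_rescale_leftField {f : (Fin d → ℝ) → ℝ} (hf : Differentiable ℝ f)
    (y : Fin d → ℝ) {r : ℝ} (hr : 0 < r) (x : Fin d → ℝ) {i : Fin d} (hi : G.weight i = 1) :
    fderiv ℝ (f ∘ G.rescale y r) x (leftField G.mul i x) =
      r⁻¹ * fderiv ℝ f (G.rescale y r x) (leftField G.mul i (G.rescale y r x)) := by
  have h1 : fderiv ℝ (G.rescale y r) x =
      (dilationCLM G.weight r⁻¹).comp (fderiv ℝ (G.mul (G.inv y)) x) := by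
    have : G.rescale y r = dilationCLM G.weight r⁻¹ ∘ G.mul (G.inv y) := rfl
    rw [this, fderiv_comp _ (dilationCLM G.weight r⁻¹).differentiableAt
      (G.differentiable_mul_left _ x), ContinuousLinearMap.fderiv]
  have h2 : fderiv ℝ (G.mul (G.inv y)) x (G.frame x (Pi.single i 1)) =
      G.frame (G.mul (G.inv y) x) (Pi.single i 1) :=
    congrArg (fun L => L (Pi.single i (1 : ℝ))) (G.fderiv_mul_comp_frame (G.inv y) x)
  have h3 : G.frame (G.rescale y r x) (dilation G.weight r⁻¹ (Pi.single i 1)) =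
      dilation G.weight r⁻¹ (G.frame (G.mul (G.inv y) x) (Pi.single i 1)) :=
    congrArg (fun L => L (Pi.single i (1 : ℝ)))
      (G.frame_dilation_comp (inv_pos.2 hr) (G.mul (G.inv y) x))
  rw [fderiv_comp _ (hf _) ((G.contDiff_rescale y r).differentiable (by simp) x),
    ContinuousLinearMap.comp_apply, h1, ContinuousLinearMap.comp_apply, leftField_eq_frame, h2,
    dilationCLM_apply, ← h3, dilation_single, hi, pow_one, map_smul, map_smul, smul_eq_mul,
    leftField_eq_frame]

theorem subgradNorm_comp_rescale {f : (Fin d → ℝ) → ℝ} (hf : Differentiable ℝ f)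
    (y : Fin d → ℝ) {r : ℝ} (hr : 0 < r) (x : Fin d → ℝ) :
    G.subgradNorm (f ∘ G.rescale y r) x = r⁻¹ * G.subgradNorm f (G.rescale y r x) := by
  have h : ∑ i with G.weight i = 1, (fderiv ℝ (f ∘ G.rescale y r) x (leftField G.mul i x)) ^ 2 =
      r⁻¹ ^ 2 * ∑ i with G.weight i = 1,
        (fderiv ℝ f (G.rescale y r x) (leftField G.mul i (G.rescale y r x))) ^ 2 := by
    rw [Finset.mul_sum]
    refine Finset.sum_congr rfl fun i hi => ?_
    rw [G.fderiv_comp_rescale_leftField hf y hr x (Finset.mem_filter.1 hi).2, mul_pow]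
  rw [subgradNorm, subgradNorm, h, Real.sqrt_mul (by positivity),
    Real.sqrt_sq (by positivity)]

theorem subgradNorm_nonneg (f : (Fin d → ℝ) → ℝ) (x : Fin d → ℝ) : 0 ≤ G.subgradNorm f x :=
  Real.sqrt_nonneg _

theorem continuous_subgradNorm {f : (Fin d → ℝ) → ℝ} (hf : ContDiff ℝ 1 f) :
    Continuous (G.subgradNorm f) := by
  refine Real.continuous_sqrt.comp (continuous_finsetSum _ fun i _ => ?_)
  exact ((hf.continuous_fderiv one_ne_zero).clm_apply
    (G.contDiff_frame.continuous.clm_apply continuous_const)).pow 2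

theorem subgradNorm_eq_zero_of_notMem_tsupport {f : (Fin d → ℝ) → ℝ} {x : Fin d → ℝ}
    (hx : x ∉ tsupport f) : G.subgradNorm f x = 0 := by
  have h : fderiv ℝ f x = 0 := by
    have h0 : f =ᶠ[nhds x] fun _ => 0 := notMem_tsupport_iff_eventuallyEq.1 hx
    rw [h0.fderiv_eq, fderiv_fun_const]
    rfl
  simp [subgradNorm, h]

/-- What the inequality says for a cutoff function of a set `s` of small measure. -/
theorem LogSobolev.cutoff_bound {G : StratifiedGroup d} {μ : Measure (Fin d → ℝ)}
    [IsProbabilityMeasure μ] {β q : ℝ} (hβ : 0 ≤ β) (hq : 0 < q) (h : G.LogSobolev μ β q) :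
    ∃ C D : ℝ, 0 ≤ C ∧ 0 ≤ D ∧ ∀ (f : (Fin d → ℝ) → ℝ) (s t : Set (Fin d → ℝ)) (κ ℓ : ℝ), LocallyLipschitz f →
      Continuous (G.subgradNorm f) → MeasurableSet s → MeasurableSet t →
      (∀ x, 0 ≤ f x) → (∀ x, f x ≤ 1) → (∀ x ∈ t, f x = 1) → (∀ x ∉ s, f x = 0) →
      (∀ x, G.subgradNorm f x ≤ κ) → (∀ x ∉ s, G.subgradNorm f x = 0) → 0 < μ.real t →
      0 ≤ ℓ → μ.real s ≤ Real.exp (-ℓ) →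
      ℓ ^ β * μ.real t ≤ (C * κ ^ q + D) * μ.real s := by
  obtain ⟨C, D, hC, hD, h⟩ := h
  refine ⟨C, D, hC, hD, fun f s t κ ℓ hf hgc hs ht h0 h1 hft hfs hκ hgs htpos hℓ hℓs => ?_⟩
  have hfc : Continuous fun x => |f x| ^ q :=
    hf.continuous.abs.rpow_const fun _ => Or.inr hq.le
  have hf01 : ∀ x, |f x| ^ q ≤ 1 := fun x =>
    Real.rpow_le_one (abs_nonneg _) ((abs_of_nonneg (h0 x)).le.trans (h1 x)) hq.le
  have hi1 : Integrable (fun x => |f x| ^ q) μ :=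
    Integrable.of_bound hfc.aestronglyMeasurable 1 (Filter.Eventually.of_forall fun x => by
      rw [Real.norm_of_nonneg (by positivity)]
      exact hf01 x)
  have hgκ : ∀ x, G.subgradNorm f x ^ q ≤ κ ^ q := fun x =>
    Real.rpow_le_rpow (G.subgradNorm_nonneg f x) (hκ x) hq.le
  have hi2 : Integrable (fun x => G.subgradNorm f x ^ q) μ :=
    Integrable.of_bound (hgc.rpow_const fun _ => Or.inr hq.le).aestronglyMeasurable (κ ^ q)
      (Filter.Eventually.of_forall fun x => by
        rw [Real.norm_of_nonneg (Real.rpow_nonneg (G.subgradNorm_nonneg f x) q)]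
        exact hgκ x)
  set m := ∫ x, |f x| ^ q ∂μ
  have hms : m ≤ μ.real s := by
    rw [← integral_indicator_one hs]
    refine integral_mono hi1 ((integrable_const 1).indicator hs) fun x => ?_
    by_cases hx : x ∈ s
    · simpa [hx] using hf01 x
    · simp [hx, hfs x hx, Real.zero_rpow hq.ne']
  have hmt : μ.real t ≤ m := by
    rw [← integral_indicator_one ht]
    refine integral_mono ((integrable_const 1).indicator ht) hi1 fun x => ?_
    by_cases hx : x ∈ t
    · simp [hx, hft x hx]
    · simp only [Set.indicator_of_notMem hx]
      positivity
  have hmg : ∫ x, G.subgradNorm f x ^ q ∂μ ≤ κ ^ q * μ.real s := by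
    have : κ ^ q * μ.real s = ∫ x, s.indicator (fun _ => κ ^ q) x ∂μ := by
      rw [integral_indicator_const _ hs, smul_eq_mul, mul_comm]
    rw [this]
    refine integral_mono hi2 ((integrable_const _).indicator hs) fun x => ?_
    by_cases hx : x ∈ s
    · simpa [hx] using hgκ x
    · simp [hx, hgs x hx, Real.zero_rpow hq.ne']
  have hmpos : 0 < m := htpos.trans_le hmt
  -- On `t` the cutoff equals one, so the logarithm there depends only on `m`, which is at most `e ^
  -- (-ℓ)`.
  have hlog : ℓ ≤ |Real.log (1 / m)| := by
    rw [one_div, Real.log_inv, abs_neg]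
    have : Real.log m ≤ -ℓ := (Real.log_le_iff_le_exp hmpos).2 (hms.trans hℓs)
    exact le_trans (by linarith) (neg_le_abs _)
  have hlow : ENNReal.ofReal (ℓ ^ β * μ.real t) ≤
      ∫⁻ x, ENNReal.ofReal (|f x| ^ q * |Real.log (|f x| ^ q / m)| ^ β) ∂μ := by
    calc ENNReal.ofReal (ℓ ^ β * μ.real t) = ∫⁻ _ in t, ENNReal.ofReal (ℓ ^ β) ∂μ := by
          rw [setLIntegral_const, ENNReal.ofReal_mul (by positivity), ofReal_measureReal]
      _ ≤ ∫⁻ x in t, ENNReal.ofReal (|f x| ^ q * |Real.log (|f x| ^ q / m)| ^ β) ∂μ := by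
          refine setLIntegral_mono' ht fun x hx => ENNReal.ofReal_le_ofReal ?_
          rw [hft x hx, abs_one, Real.one_rpow, one_mul]
          exact Real.rpow_le_rpow hℓ hlog hβ
      _ ≤ _ := setLIntegral_le_lintegral _ _
  have hup := hlow.trans (h f hf hi1 hi2)
  have hg0 : 0 ≤ ∫ x, G.subgradNorm f x ^ q ∂μ :=
    integral_nonneg fun x => Real.rpow_nonneg (G.subgradNorm_nonneg f x) q
  rw [ENNReal.ofReal_le_ofReal_iff (by positivity)] at hup
  calc ℓ ^ β * μ.real t ≤ C * ∫ x, G.subgradNorm f x ^ q ∂μ + D * m := hup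
    _ ≤ C * (κ ^ q * μ.real s) + D * μ.real s := by gcongr
    _ = (C * κ ^ q + D) * μ.real s := by ring

end StratifiedGroup

/-! ### Oscillation near dilated critical points and the growth condition -/

namespace StratifiedGroup

variable {d : ℕ} {G : StratifiedGroup d} {N : (Fin d → ℝ) → ℝ}

/-- Along the dilates of a horizontal critical point, `N ^ p` is constant up to a bounded error on
translated balls of radius `t ^ (1 - p / 2)`. -/
theorem IsSmoothHomogeneousNorm.exists_oscillation_bound (hN : G.IsSmoothHomogeneousNorm N)
    (hG : G.Noncommutative) {p : ℝ} (hp : 0 < p) (R : ℝ) :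
    ∃ x₀, ∃ a > 0, ∃ B, ∀ᶠ t : ℝ in Filter.atTop, ∀ k, ‖k‖ ≤ R →
      |N (G.mul (dilation G.weight t x₀) (dilation G.weight (t ^ (1 - p / 2)) k)) ^ p -
        a * t ^ p| ≤ B := by
  obtain ⟨x₀, hx₀, hcrit⟩ := hN.exists_horizontal_critical_point hG
  have hNx := hN.pos hx₀
  have hd : HasFDerivAt (fun z => N (G.mul x₀ z) ^ p)
      ((p * N (G.mul x₀ 0) ^ (p - 1)) • (fderiv ℝ N x₀).comp (G.frame x₀)) 0 := by
    have h1 : HasFDerivAt N (fderiv ℝ N x₀) (G.mul x₀ 0) := by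
      rw [G.mul_zero]
      exact (hN.differentiableAt hx₀).hasFDerivAt
    refine (h1.comp 0 (G.differentiable_mul_left x₀ 0).hasFDerivAt).rpow_const (Or.inl ?_)
    rw [Function.comp_apply, G.mul_zero]
    exact hNx.ne'
  have hsmooth : ContDiffAt ℝ 2 (fun z => N (G.mul x₀ z) ^ p) 0 := by
    have h1 : ContDiffAt ℝ ∞ N (G.mul x₀ 0) := by
      rw [G.mul_zero]
      exact hN.contDiffAt hx₀
    have h2 : ContDiffAt ℝ ∞ (fun z => N (G.mul x₀ z) ^ p) 0 := by
      refine (h1.comp 0 (G.contDiff_mul_left x₀).contDiffAt).rpow_const_of_ne ?_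
      rw [Function.comp_apply, G.mul_zero]
      exact hNx.ne'
    exact h2.of_le (by norm_cast)
  obtain ⟨C, ε₀, hε₀, hC⟩ := exists_dilation_quadratic_bound G.weight_pos hsmooth
    (fun i hi => by
      rw [hd.fderiv, smul_apply, ContinuousLinearMap.comp_apply,
        ← leftField_eq_frame, hcrit i hi, smul_zero]) R
  refine ⟨x₀, N x₀ ^ p, by positivity, C, ?_⟩
  have hsmall : ∀ᶠ t : ℝ in Filter.atTop, t ^ (-(p / 2)) < ε₀ :=
    (tendsto_rpow_neg_atTop (half_pos hp)).eventually (gt_mem_nhds hε₀)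
  filter_upwards [hsmall, Filter.eventually_gt_atTop 0] with t ht ht0 k hk
  set ε := t ^ (-(p / 2))
  have hε : 0 < ε := by positivity
  have hr : t ^ (1 - p / 2) = t * ε := by
    rw [sub_eq_add_neg, Real.rpow_add ht0, Real.rpow_one]
  -- The radius is chosen so that the quadratic gain exactly cancels the growth of `N ^ p`.
  have hone : t ^ p * ε ^ 2 = 1 := by
    rw [← Real.rpow_natCast, ← Real.rpow_mul ht0.le, ← Real.rpow_add ht0]
    norm_num
  rw [hr, ← dilation_dilation, ← G.dilation_mul t ht0, hN.homogeneous t ht0,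
    Real.mul_rpow ht0.le (hN.nonneg _), mul_comm (N x₀ ^ p), ← mul_sub, abs_mul,
    abs_of_pos (by positivity : 0 < t ^ p)]
  have h := hC ε hε ht k hk
  rw [G.mul_zero] at h
  calc t ^ p * |N (G.mul x₀ (dilation G.weight ε k)) ^ p - N x₀ ^ p|
      ≤ t ^ p * (C * ε ^ 2) := by gcongr
    _ = C * (t ^ p * ε ^ 2) := by ring
    _ = C := by rw [hone, mul_one]

/-- The sub-gradient of a bump function is bounded. -/
theorem exists_subgradNorm_bump_le (G : StratifiedGroup d) (ψ : ContDiffBump (0 : Fin d → ℝ)) :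
    ∃ K ≥ 0, ∀ x, G.subgradNorm ψ x ≤ K := by
  obtain ⟨K, hK⟩ := (isCompact_closedBall (0 : Fin d → ℝ) ψ.rOut).exists_bound_of_continuousOn
    (G.continuous_subgradNorm ψ.contDiff).continuousOn
  refine ⟨max K 0, le_max_right _ _, fun x => ?_⟩
  by_cases hx : x ∈ Metric.closedBall (0 : Fin d → ℝ) ψ.rOut
  · exact (le_abs_self _).trans ((hK x hx).trans (le_max_left _ _))
  · rw [G.subgradNorm_eq_zero_of_notMem_tsupport (by rwa [ψ.tsupport_eq])]
    exact le_max_right _ _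

/-- The `Log^β`-Sobolev inequality forces a growth condition, through cutoff functions
concentrated near the dilates of a horizontal critical point of `N`. -/
theorem LogSobolev.growth_bound (hG : G.Noncommutative) (hN : G.IsSmoothHomogeneousNorm N)
    {α p β q : ℝ} (hα : 0 < α) (hp : 1 ≤ p) (hβ : 0 ≤ β) (hq : 0 < q)
    (h : G.LogSobolev (gibbsMeasure N α p) β q) :
    ∃ c > 0, ∃ b A D : ℝ, ∀ᶠ t : ℝ in Filter.atTop,
      0 ≤ c * t ^ p - b → (c * t ^ p - b) ^ β ≤ A * t ^ (q * (p / 2 - 1)) + D := by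
  have := hN.isProbabilityMeasure_gibbsMeasure hα hp
  obtain ⟨C, D, hC, hD, hcut⟩ := h.cutoff_bound hβ hq
  obtain ⟨x₀, a, ha, B, hosc⟩ := hN.exists_oscillation_bound hG (zero_lt_one.trans_le hp) 2
  obtain ⟨L, hL⟩ := hN.exists_gibbsMeasure_real_le_exp hα hp
  let ψ : ContDiffBump (0 : Fin d → ℝ) := ⟨1, 2, by norm_num, by norm_num⟩
  obtain ⟨K, hK0, hK⟩ := G.exists_subgradNorm_bump_le ψ
  have hψ : ContDiff ℝ 1 ψ := ψ.contDiff
  set b₁ := Metric.closedBall (0 : Fin d → ℝ) 1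
  set b₂ := Metric.closedBall (0 : Fin d → ℝ) 2
  set μ := gibbsMeasure N α p
  have hV₁ : 0 < volume.real b₁ :=
    ENNReal.toReal_pos (Metric.measure_closedBall_pos _ _ one_pos).ne'
      measure_closedBall_lt_top.ne
  -- This bounds the ratio of the masses of the outer and inner balls: the oscillation of the
  -- density times the volume ratio, in which the Jacobian `J` cancels.
  set Λ := Real.exp (2 * (α * B)) * (volume.real b₂ / volume.real b₁)
  refine ⟨α * a / 2, by positivity, α * B / 2 + L, Λ * (C * K ^ q), Λ * D, ?_⟩
  filter_upwards [hosc, Filter.eventually_gt_atTop 0] with t ht ht0 hℓ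
  set r := t ^ (1 - p / 2)
  have hr : 0 < r := by positivity
  set y := dilation G.weight t x₀
  set s₁ := G.rescale y r ⁻¹' b₁
  set s₂ := G.rescale y r ⁻¹' b₂
  have hcont := (G.contDiff_rescale y r).continuous
  have hm₁ : MeasurableSet s₁ := hcont.measurable Metric.isClosed_closedBall.measurableSet
  have hm₂ : MeasurableSet s₂ := hcont.measurable Metric.isClosed_closedBall.measurableSet
  have hs : s₁ ⊆ s₂ := Set.preimage_mono (Metric.closedBall_subset_closedBall (by norm_num))
  have hbd : ∀ x ∈ s₂, |N x ^ p - a * t ^ p| ≤ B := by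
    intro x hx
    have := ht (G.rescale y r x) (by simpa [s₂, b₂] using hx)
    rwa [G.mul_dilation_rescale y hr.ne'] at this
  have hlow : ∀ x ∈ s₂, α * (a * t ^ p) - α * B ≤ α * N x ^ p := fun x hx => by
    have := (abs_le.1 (hbd x hx)).1
    rw [← mul_sub]
    exact mul_le_mul_of_nonneg_left (by linarith) hα.le
  have hupp : ∀ x ∈ s₂, α * N x ^ p ≤ α * (a * t ^ p) + α * B := fun x hx => by
    have := (abs_le.1 (hbd x hx)).2
    rw [← mul_add]
    exact mul_le_mul_of_nonneg_left (by linarith) hα.le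
  obtain ⟨J, hJ0, hJt, hJ⟩ := G.exists_volume_rescale_preimage y hr
  have hJpos : 0 < J.toReal := ENNReal.toReal_pos hJ0 hJt
  have hv₁ : volume s₁ = J * volume b₁ := hJ _ Metric.isClosed_closedBall.measurableSet
  have hv₂ : volume s₂ = J * volume b₂ := hJ _ Metric.isClosed_closedBall.measurableSet
  have hr₁ : volume.real s₁ = J.toReal * volume.real b₁ := by
    rw [Measure.real, hv₁, ENNReal.toReal_mul, Measure.real]
  have hr₂ : volume.real s₂ = J.toReal * volume.real b₂ := by
    rw [Measure.real, hv₂, ENNReal.toReal_mul, Measure.real]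
  have hZ : 0 < (∫ x, Real.exp (-α * N x ^ p))⁻¹ :=
    inv_pos.2 (integral_exp_pos (hN.integrable_exp hα hp))
  have hμ₁ := hN.le_gibbsMeasure_real hα hp hm₁
    (by rw [hv₁]; exact ENNReal.mul_ne_top hJt measure_closedBall_lt_top.ne)
    fun x hx => hupp x (hs hx)
  have hμ₂ := hN.gibbsMeasure_real_le hα hp hm₂
    (by rw [hv₂]; exact ENNReal.mul_ne_top hJt measure_closedBall_lt_top.ne) hlow
  rw [hr₁] at hμ₁
  rw [hr₂] at hμ₂
  have hpos₁ : 0 < μ.real s₁ := lt_of_lt_of_le (by positivity) hμ₁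
  have hratio : μ.real s₂ ≤ Λ * μ.real s₁ := by
    refine hμ₂.trans (le_trans (le_of_eq ?_) (mul_le_mul_of_nonneg_left hμ₁ (by positivity)))
    have he : Real.exp (-(α * (a * t ^ p) - α * B)) =
        Real.exp (2 * (α * B)) * Real.exp (-(α * (a * t ^ p) + α * B)) := by
      rw [← Real.exp_add]
      ring_nf
    rw [he]
    simp only [Λ]
    field_simp
  -- The bound independent of volume is used here, so the growth or decay of `J` with `t` plays no
  -- role; it only halves the exponent.
  have hsmall : μ.real s₂ ≤ Real.exp (-(α * a / 2 * t ^ p - (α * B / 2 + L))) := by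
    refine (hL s₂ _ hm₂ hlow).trans (le_of_eq ?_)
    ring_nf
  have hfsmooth : ContDiff ℝ 1 (ψ ∘ G.rescale y r) :=
    hψ.comp ((G.contDiff_rescale y r).of_le (by norm_cast))
  have hsub := G.subgradNorm_comp_rescale (hψ.differentiable one_ne_zero) y hr
  have hfin := hcut (ψ ∘ G.rescale y r) s₂ s₁ (r⁻¹ * K) _ hfsmooth.locallyLipschitz
    (G.continuous_subgradNorm hfsmooth) hm₂ hm₁ (fun _ => ψ.nonneg) (fun _ => ψ.le_one)
    (fun x hx => ψ.one_of_mem_closedBall hx)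
    (fun x hx => ψ.zero_of_le_dist (not_le.1 hx).le)
    (fun x => by
      rw [hsub]
      exact mul_le_mul_of_nonneg_left (hK _) (by positivity))
    (fun x hx => by
      rw [hsub, G.subgradNorm_eq_zero_of_notMem_tsupport (by rwa [ψ.tsupport_eq]),
        MulZeroClass.mul_zero])
    hpos₁ hℓ hsmall
  have hrK : (r⁻¹ * K) ^ q = t ^ (q * (p / 2 - 1)) * K ^ q := by
    rw [Real.mul_rpow (by positivity) hK0, ← Real.rpow_neg ht0.le, ← Real.rpow_mul ht0.le]
    ring_nf
  rw [hrK] at hfin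
  refine le_of_mul_le_mul_right (hfin.trans ?_) hpos₁
  calc (C * (t ^ (q * (p / 2 - 1)) * K ^ q) + D) * μ.real s₂
      ≤ (C * (t ^ (q * (p / 2 - 1)) * K ^ q) + D) * (Λ * μ.real s₁) := by gcongr
    _ = (Λ * (C * K ^ q) * t ^ (q * (p / 2 - 1)) + Λ * D) * μ.real s₁ := by ring

end StratifiedGroup

/-- Divided by `t ^ (p * β)`, the right-hand side tends to zero while the left-hand side stays above
`(c / 2) ^ β`. -/
theorem not_eventually_rpow_le {c b A D β γ p : ℝ} (hc : 0 < c) (hp : 0 < p) (hβ : 0 < β)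
    (hγ : γ < p * β) :
    ¬ ∀ᶠ t : ℝ in Filter.atTop,
      0 ≤ c * t ^ p - b → (c * t ^ p - b) ^ β ≤ A * t ^ γ + D := by
  intro h
  have hpβ : 0 < p * β := mul_pos hp hβ
  have hlim : Filter.Tendsto (fun t : ℝ => A * t ^ (-(p * β - γ)) + D * t ^ (-(p * β)))
      Filter.atTop (nhds 0) := by
    simpa using ((tendsto_rpow_neg_atTop (sub_pos.2 hγ)).const_mul A).add
      ((tendsto_rpow_neg_atTop hpβ).const_mul D)
  have hbig : ∀ᶠ t : ℝ in Filter.atTop, 2 * |b| / c ≤ t ^ p :=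
    (tendsto_rpow_atTop hp).eventually_ge_atTop _
  have hle : (c / 2) ^ β ≤ 0 := by
    refine ge_of_tendsto hlim ?_
    filter_upwards [h, hbig, Filter.eventually_gt_atTop 0] with t ht hb ht0
    rw [div_le_iff₀ hc] at hb
    have h1 : c / 2 * t ^ p ≤ c * t ^ p - b := by linarith [le_abs_self b]
    have h2 : 0 ≤ c / 2 * t ^ p := by positivity
    have h3 := (Real.rpow_le_rpow h2 h1 hβ.le).trans (ht (h2.trans h1))
    rw [Real.mul_rpow (by positivity) (by positivity), ← Real.rpow_mul ht0.le] at h3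
    have h4 : 0 < t ^ (p * β) := by positivity
    rw [Real.rpow_neg ht0.le (p * β), Real.rpow_neg ht0.le, Real.rpow_sub ht0]
    calc (c / 2) ^ β ≤ (A * t ^ γ + D) / t ^ (p * β) := (le_div_iff₀ h4).2 h3
      _ = _ := by
        have : 0 < t ^ γ := by positivity
        field_simp
  exact absurd hle (not_le.2 (by positivity))

end

theorem theorem10 {d : ℕ} (G : StratifiedGroup d) (hG : G.Noncommutative)
    (N : (Fin d → ℝ) → ℝ) (hN : G.IsSmoothHomogeneousNorm N)
    (α p : ℝ) (hα : 0 < α) (hp : 1 ≤ p)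
    (β q : ℝ) (hβ : 0 < β) (hβ1 : β ≤ 1)
    -- `q < 2pβ/(p-1)`, read as no condition when `p = 1`
    (hq : 1 < q) (hq' : q * (p - 1) < 2 * p * β) :
    ¬ G.LogSobolev (gibbsMeasure N α p) β q := by
  intro h
  obtain ⟨c, hc, b, A, D, hbound⟩ := h.growth_bound hG hN hα hp hβ.le (by linarith)
  -- The exponent condition is `q * (p - 2) < 2 * p * β`, which follows from `hq'` because `q > 0`.
  exact not_eventually_rpow_le hc (by linarith) hβ (by nlinarith) hbound
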